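/- **Setting.** Let $\mathbb T^d=\mathbb R^d/\mathbb Z^d$ with its normalized Lebesgue measure (up to the rescaling $x\mapsto 2\pi x$ this is the periodic box $[0,2\pi]^d$). For $s\ge 0$ let $H^s(\mathbb T^d;\mathbb R^m)$ be the space of $u\in L^2(\mathbb T^d;\mathbb R^m)$ with $\|u\|_{H^s}^2=\sum_{\xi\in\mathbb Z^d}(1+|\xi|^2)^s|\hat u(\xi)|^2<\infty$, where $\hat u(\xi)=\mathcal F(u)(\xi)=\int_{\mathbb T^d}u(x)e^{-2\pi i\xi\cdot x}\,dx$. Let $T>0$, and let $C([0,T]\times H^{s'})$ denote the space of continuous functions $u:[0,T]\to H^{s'}$ with the norm $\max_{0\le t\le T}\|u(t)\|_{H^{s'}}$. Let $\sigma:\mathbb R\to\mathbb R$ be an activation function. A *continuous-time Fourier neural operator* (CTFNO) is a composition $$\mathcal N=\mathcal Q\circ\mathcal L_L\circ\cdots\circ\mathcal L_1\circ\mathcal P,\qquad L\ge 1,$$ with a width $d_v$, a lifting $\mathcal P(a)(t,x)=Pa(x)$, $P\in\mathbb R^{d_v\times d_a}$, a projection $\mathcal Q(v)(t,x)=Qv(t,x)$,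 $Q\in\mathbb R^{d_u\times d_v}$, and layers $$\mathcal L_\ell(v)(t,x)=\sigma\Big(W_\ell\,\psi_{w,\ell}(t)\,v(t,x)+\psi_{b,\ell}(t)\odot b_\ell(x)+\mathcal F^{-1}\big(\varphi_\ell(t,\xi)R_\ell(\xi)\,\mathcal F(v(t,\cdot))(\xi)\big)(x)\Big),$$ where $\sigma$ acts componentwise, $\odot$ is the componentwise product, $W_\ell\in\mathbb R^{d_v\times d_v}$, $\psi_{w,\ell}$ is a continuous function from $[0,T]$ to the diagonal $d_v\times d_v$ matrices, $\psi_{b,\ell}:[0,T]\to\mathbb R^{d_v}$ is continuous, $b_\ell:\mathbb T^d\to\mathbb R^{d_v}$ is smooth, $R_\ell(\xi)\in\mathbb C^{d_v\times d_v}$ vanishes for all but finitely many $\xi\in\mathbb Z^d$ and satisfies $R_\ell(-\xi)=\overline{R_\ell(\xi)}$, and $\varphi_\ell(\cdot,\xi):[0,T]\to\mathbb R$ is continuous with $\varphi_\ell(t,-\xi)=\varphi_\ell(t,\xi)$. An operator from $H^s(\mathbb T^d;\mathbb R^{d_a})$ to $C([0,T]\times H^{s'}(\mathbb T^d;\mathbb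 R^{d_u}))$ is called a CTFNO if it is of this form, all its intermediate states $\mathcal L_\ell\circ\cdots\circ\mathcal L_1\circ\mathcal P(a)$, $0\le\ell\le L$, being continuous functions from $[0,T]$ to $L^2(\mathbb T^d;\mathbb R^{d_v})$. **Theorem (Universal approximation of CTFNO).** Let $s,s'\ge 0$. Assume that the activation function $\sigma$ is not a polynomial and is of class $C^k$ for some integer $k\ge s'$. Let $\mathcal G:H^s(\mathbb T^d;\mathbb R^{d_a})\to C([0,T]\times H^{s'}(\mathbb T^d;\mathbb R^{d_u}))$ be a continuous operator and let $K\subset H^s(\mathbb T^d;\mathbb R^{d_a})$ be compact. Then for every $\epsilon>0$ there exists a CTFNO $\mathcal N:H^s(\mathbb T^d;\mathbb R^{d_a})\to C([0,T]\times H^{s'}(\mathbb T^d;\mathbb R^{d_u}))$ with activation function $\sigma$, continuous as an operator between these spaces, such that $$\sup_{a\in K}\big\|\mathcal G(a)-\mathcal N(a)\big\|_{C([0,T]\times H^{s'}(\mathbb T^d;\mathbb R^{d_u}))}<\epsilon .$$ -/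

import Mathlib

open MeasureTheory Polynomial
open scoped ENNReal ContDiff Matrix

noncomputable section

namespace TFNO

/-- The periodic torus `𝕋^d = (ℝ/ℤ)^d`. -/
abbrev Torus (d : ℕ) : Type := UnitAddTorus (Fin d)

/-- The normalized Haar (Lebesgue) measure on the torus. It is the measure with respect to which
`UnitAddTorus.mFourierCoeff` is computed. -/
def torusMeasure (d : ℕ) : Measure (Torus d) :=
  Measure.pi fun _ => AddCircle.haarAddCircle

instance (d : ℕ) : IsProbabilityMeasure (torusMeasure d) := by
  unfold torusMeasure; infer_instance

/-- The space `L²(𝕋^d; ℝ^m)`. -/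
abbrev L2 (d m : ℕ) : Type := Lp (EuclideanSpace ℝ (Fin m)) 2 (torusMeasure d)

/-- The Fourier coefficient at the wavenumber `ξ` of a real function on the torus. -/
def fourierCoeffReal {d : ℕ} (f : Torus d → ℝ) (ξ : Fin d → ℤ) : ℂ :=
  UnitAddTorus.mFourierCoeff (fun x => (f x : ℂ)) ξ

/-- The Sobolev weight `(1 + |ξ|²)^{s/2}`. -/
def sobolevWeight {d : ℕ} (s : ℝ) (ξ : Fin d → ℤ) : ℝ :=
  (1 + ∑ i, (ξ i : ℝ) ^ 2) ^ (s / 2)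

lemma sobolevWeight_pos {d : ℕ} (s : ℝ) (ξ : Fin d → ℤ) : 0 < sobolevWeight s ξ := by
  unfold sobolevWeight; positivity

/-- The family `(1 + |ξ|²)^{s/2} û_i(ξ)`, indexed by wavenumbers `ξ` and components `i`. -/
def weightedCoeff {d m : ℕ} (s : ℝ) (u : L2 d m) : (Fin d → ℤ) × Fin m → ℂ :=
  fun p => sobolevWeight s p.1 * fourierCoeffReal (fun x => u x p.2) p.1

lemma memLp_component {d m : ℕ} (u : L2 d m) (i : Fin m) :
    MemLp (fun x => ((u x i : ℝ) : ℂ)) 2 (torusMeasure d) := by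
  have h := Lp.memLp u
  exact (Complex.ofRealCLM.comp
    (EuclideanSpace.proj i : EuclideanSpace ℝ (Fin m) →L[ℝ] ℝ)).comp_memLp' h

lemma integrable_mFourier_mul {d : ℕ} {f : Torus d → ℂ} (hf : MemLp f 2 (torusMeasure d))
    (ξ : Fin d → ℤ) :
    Integrable (fun x => UnitAddTorus.mFourier ξ x • f x) (torusMeasure d) := by
  have h1 : Integrable f (torusMeasure d) := hf.integrable (by norm_num)
  simp only [smul_eq_mul]
  refine h1.bdd_mul (c := 1) ?_ (Filter.Eventually.of_forall fun x => ?_)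
  · exact (UnitAddTorus.mFourier ξ).continuous.aestronglyMeasurable
  · exact ((UnitAddTorus.mFourier ξ).norm_coe_le_norm x).trans UnitAddTorus.mFourier_norm.le

lemma weightedCoeff_add {d m : ℕ} (s : ℝ) (u v : L2 d m) :
    weightedCoeff s (u + v) = weightedCoeff s u + weightedCoeff s v := by
  funext p
  simp only [weightedCoeff, fourierCoeffReal, Pi.add_apply, ← mul_add]
  congr 1
  change ∫ x, _ ∂(torusMeasure d) = ∫ x, _ ∂(torusMeasure d) + ∫ x, _ ∂(torusMeasure d)
  rw [← integral_add (integrable_mFourier_mul (memLp_component u p.2) _)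
    (integrable_mFourier_mul (memLp_component v p.2) _)]
  refine integral_congr_ae ?_
  filter_upwards [Lp.coeFn_add u v] with x hx
  rw [hx]
  simp [mul_add]

lemma weightedCoeff_smul {d m : ℕ} (s : ℝ) (c : ℝ) (u : L2 d m) :
    weightedCoeff s (c • u) = c • weightedCoeff s u := by
  funext p
  simp only [weightedCoeff, fourierCoeffReal, Pi.smul_apply, Complex.real_smul]
  rw [mul_left_comm]
  congr 1
  change ∫ x, _ ∂(torusMeasure d) = (c : ℂ) * ∫ x, _ ∂(torusMeasure d)
  rw [← integral_const_mul]
  refine integral_congr_ae ?_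
  filter_upwards [Lp.coeFn_smul c u] with x hx
  rw [hx]
  simp [mul_left_comm]

lemma eq_zero_of_weightedCoeff {d m : ℕ} (s : ℝ) (u : L2 d m) (h : weightedCoeff s u = 0) :
    u = 0 := by
  have key : ∀ i, (fun x => ((u x i : ℝ) : ℂ)) =ᵐ[torusMeasure d] 0 := by
    intro i
    have hm := memLp_component u i
    have h0 : UnitAddTorus.mFourierBasis.repr (hm.toLp _) = 0 := by
      ext ξ
      refine (UnitAddTorus.mFourierBasis_repr (hm.toLp _) ξ).trans ?_
      have hc : UnitAddTorus.mFourierCoeff (hm.toLp _) ξ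
          = fourierCoeffReal (fun x => u x i) ξ := by
        refine integral_congr_ae ?_
        filter_upwards [hm.coeFn_toLp] with x hx
        rw [hx]
      have h1 := congrFun h (ξ, i)
      simp only [weightedCoeff, Pi.zero_apply, mul_eq_zero, Complex.ofReal_eq_zero,
        (sobolevWeight_pos s ξ).ne', false_or] at h1
      exact hc.trans h1
    have h2 : hm.toLp _ = 0 := UnitAddTorus.mFourierBasis.repr.map_eq_zero_iff.1 h0
    have h3 := hm.coeFn_toLp
    have h4 := Lp.coeFn_zero ℂ 2 (torusMeasure d)
    filter_upwards [h3, h4] with x hx hx'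
    rw [← hx, h2, hx']
  refine Lp.ext ?_
  filter_upwards [ae_all_iff.2 key, Lp.coeFn_zero (EuclideanSpace ℝ (Fin m)) 2 (torusMeasure d)]
    with x hx hx'
  rw [hx']
  ext i
  simpa using hx i

/-- The subspace of `u ∈ L²(𝕋^d; ℝ^m)` with `∑_ξ (1 + |ξ|²)^s |û(ξ)|² < ∞`. -/
def sobolevSubmodule (s : ℝ) (d m : ℕ) : Submodule ℝ (L2 d m) where
  carrier := {u | Memℓp (weightedCoeff s u) 2}
  add_mem' {u v} hu hv := by
    simp only [Set.mem_ofPred_eq] at *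
    rw [weightedCoeff_add]; exact hu.add hv
  zero_mem' := by
    have : weightedCoeff s (0 : L2 d m) = 0 := by
      simpa using weightedCoeff_smul s 0 (0 : L2 d m)
    simp only [Set.mem_ofPred_eq]
    rw [this]; exact zero_memℓp
  smul_mem' c u hu := by
    simp only [Set.mem_ofPred_eq] at *
    rw [weightedCoeff_smul]; exact hu.const_smul c

/-- The Sobolev space `H^s(𝕋^d; ℝ^m)` (for `s ≥ 0`). It is a type of its own, since it carries the
`H^s` norm and not the norm inherited from `L²`. -/
def Hs (s : ℝ) (d m : ℕ) : Type := ↥(sobolevSubmodule s d m)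

namespace Hs

variable {s : ℝ} {d m : ℕ}

instance : AddCommGroup (Hs s d m) := inferInstanceAs (AddCommGroup ↥(sobolevSubmodule s d m))

instance : Module ℝ (Hs s d m) := inferInstanceAs (Module ℝ ↥(sobolevSubmodule s d m))

/-- The underlying element of `L²(𝕋^d; ℝ^m)`. -/
def toL2 : Hs s d m →ₗ[ℝ] L2 d m := (sobolevSubmodule s d m).subtype

/-- The map `u ↦ ((1 + |ξ|²)^{s/2} û_i(ξ))_{ξ,i}` into `ℓ²`; the `H^s` norm is the `ℓ²` norm of
this family. -/
def toLittleL2 : Hs s d m →ₗ[ℝ] lp (fun _ : (Fin d → ℤ) × Fin m => ℂ) 2 where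
  toFun u := ⟨weightedCoeff s (toL2 u), u.2⟩
  map_add' u v := by
    ext1
    change weightedCoeff s (toL2 (u + v)) = weightedCoeff s (toL2 u) + weightedCoeff s (toL2 v)
    rw [map_add, weightedCoeff_add]
  map_smul' c u := by
    ext1
    change weightedCoeff s (toL2 (c • u)) = c • weightedCoeff s (toL2 u)
    rw [map_smul, weightedCoeff_smul]

lemma toLittleL2_injective :
    Function.Injective (toLittleL2 : Hs s d m →ₗ[ℝ] lp (fun _ : (Fin d → ℤ) × Fin m => ℂ) 2) := by
  rw [injective_iff_map_eq_zero]
  intro u hu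
  have h : weightedCoeff s (toL2 u) = 0 := congrArg Subtype.val hu
  exact Subtype.ext (eq_zero_of_weightedCoeff s _ h)

/-- The norm `‖u‖_{H^s} = (∑_ξ (1 + |ξ|²)^s |û(ξ)|²)^{1/2}`. -/
instance : NormedAddCommGroup (Hs s d m) :=
  NormedAddCommGroup.induced _ _ (toLittleL2 (s := s) (d := d) (m := m)) toLittleL2_injective

instance : NormedSpace ℝ (Hs s d m) :=
  NormedSpace.induced ℝ _ _ (toLittleL2 (s := s) (d := d) (m := m))

lemma norm_sq_eq (u : Hs s d m) :
    ‖u‖ ^ 2 = ∑' p : (Fin d → ℤ) × Fin m, (1 + ∑ i, (p.1 i : ℝ) ^ 2) ^ s *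
      ‖fourierCoeffReal (fun x => toL2 u x p.2) p.1‖ ^ 2 := by
  have h := lp.norm_rpow_eq_tsum (p := 2) (by norm_num) (toLittleL2 u)
  have h' : ‖u‖ = ‖toLittleL2 u‖ := rfl
  simp only [ENNReal.toReal_ofNat, Real.rpow_ofNat] at h
  rw [h', h]
  refine tsum_congr fun p => ?_
  change ‖weightedCoeff s (toL2 u) p‖ ^ 2 = _
  rw [weightedCoeff, norm_mul, mul_pow, Complex.norm_real, Real.norm_of_nonneg
    (sobolevWeight_pos s p.1).le, sobolevWeight]
  congr 1
  rw [← Real.rpow_natCast, ← Real.rpow_mul (by positivity)]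
  congr 1
  push_cast; ring

end Hs

/-- The parameters of one continuous-time Fourier layer of width `n` on `[0,T] × 𝕋^d`:
a weight matrix `W`, a bias function `b`, a Fourier kernel `R` with finitely many active modes,
and the continuous time modulations `ψw` (a diagonal matrix, given by its diagonal), `ψb` and `φ`.
The two symmetry conditions say that `φ(t,ξ) R(ξ)` maps real functions to real functions. -/
structure Layer (T : ℝ) (d n : ℕ) where
  W : Matrix (Fin n) (Fin n) ℝ
  ψw : C(Set.Icc (0 : ℝ) T, Fin n → ℝ)
  b : Torus d → Fin n → ℝ
  b_smooth : ContDiff ℝ ∞ fun y : Fin d → ℝ => b fun i => (y i : UnitAddCircle)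
  ψb : C(Set.Icc (0 : ℝ) T, Fin n → ℝ)
  R : (Fin d → ℤ) →₀ Matrix (Fin n) (Fin n) ℂ
  R_neg : ∀ ξ, R (-ξ) = (R ξ).map (starRingEnd ℂ)
  φ : (Fin d → ℤ) → C(Set.Icc (0 : ℝ) T, ℝ)
  φ_neg : ∀ ξ, φ (-ξ) = φ ξ

namespace Layer

variable {T : ℝ} {d n : ℕ}

/-- The function `𝓕⁻¹(φ(t,ξ) R(ξ) · 𝓕(v)(ξ))` for a function `v` on the torus, as a finite
Fourier sum with complex values. -/
def kernelℂ (l : Layer T d n) (t : Set.Icc (0 : ℝ) T) (v : Torus d → Fin n → ℝ)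
    (x : Torus d) : Fin n → ℂ :=
  ∑ ξ ∈ l.R.support, UnitAddTorus.mFourier ξ x •
    (((l.φ ξ t : ℂ) • l.R ξ) *ᵥ fun j => fourierCoeffReal (fun y => v y j) ξ)

lemma fourierCoeffReal_neg (f : Torus d → ℝ) (ξ : Fin d → ℤ) :
    fourierCoeffReal f (-ξ) = starRingEnd ℂ (fourierCoeffReal f ξ) := by
  unfold fourierCoeffReal UnitAddTorus.mFourierCoeff
  rw [← integral_conj]
  refine integral_congr_ae (Filter.Eventually.of_forall fun x => ?_)
  simp only [smul_eq_mul, map_mul, Complex.conj_ofReal, UnitAddTorus.mFourier_neg, neg_neg,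
    Complex.conj_conj]

/-- The kernel term is real, so that nothing is lost by taking real parts below. -/
lemma kernelℂ_im (l : Layer T d n) (t : Set.Icc (0 : ℝ) T) (v : Torus d → Fin n → ℝ)
    (x : Torus d) (i : Fin n) : (l.kernelℂ t v x i).im = 0 := by
  rw [← Complex.conj_eq_iff_im]
  simp only [kernelℂ, Finset.sum_apply, map_sum]
  refine Finset.sum_bij (fun ξ _ => -ξ) ?_ (fun _ _ _ _ h => neg_injective h) ?_ ?_
  · intro ξ hξ
    rw [Finsupp.mem_support_iff] at *
    rw [l.R_neg]
    intro h0
    apply hξ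
    ext a c
    simpa using congrFun (congrFun h0 a) c
  · intro ξ hξ
    refine ⟨-ξ, ?_, neg_neg ξ⟩
    rw [Finsupp.mem_support_iff] at *
    rw [l.R_neg]
    intro h0
    apply hξ
    ext a c
    simpa using congrFun (congrFun h0 a) c
  · intro ξ _
    simp only [Pi.smul_apply, smul_eq_mul, map_mul, Matrix.mulVec, dotProduct, Matrix.smul_apply,
      map_sum, Complex.conj_ofReal, l.R_neg, l.φ_neg, Matrix.map_apply, fourierCoeffReal_neg,
      UnitAddTorus.mFourier_neg]

/-- The layer at time `t`:
`σ(W ψw(t) v(x) + ψb(t) ⊙ b(x) + 𝓕⁻¹(φ(t,ξ) R(ξ) · 𝓕(v)(ξ))(x))`, with `σ` acting on each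
component. -/
def apply (l : Layer T d n) (σ : ℝ → ℝ) (t : Set.Icc (0 : ℝ) T) (v : Torus d → Fin n → ℝ)
    (x : Torus d) : Fin n → ℝ :=
  fun i => σ (((l.W * Matrix.diagonal (l.ψw t)) *ᵥ v x) i + l.ψb t i * l.b x i
    + (l.kernelℂ t v x i).re)

end Layer

/-- The parameters of a continuous-time Fourier neural operator `Q ∘ L_L ∘ ⋯ ∘ L_1 ∘ P`: the width
`n`, the depth `L ≥ 1`, the matrices of the lifting and of the projection, and the layers. -/
structure CTFNO (T : ℝ) (d da du : ℕ) where
  n : ℕ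
  P : Matrix (Fin n) (Fin da) ℝ
  L : ℕ
  L_pos : 0 < L
  layer : Fin L → Layer T d n
  Q : Matrix (Fin du) (Fin n) ℝ

namespace CTFNO

variable {T : ℝ} {d da du : ℕ}

/-- The state `(L_k ∘ ⋯ ∘ L_1 ∘ P)(a)` at time `t` (for `k ≤ L`). -/
def state (N : CTFNO T d da du) (σ : ℝ → ℝ) (a : Torus d → EuclideanSpace ℝ (Fin da))
    (t : Set.Icc (0 : ℝ) T) : ℕ → Torus d → Fin N.n → ℝ
  | 0 => fun x => N.P *ᵥ (a x).ofLp
  | k + 1 =>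
    if h : k < N.L then (N.layer ⟨k, h⟩).apply σ t (state N σ a t k) else state N σ a t k

/-- The output `(Q ∘ L_L ∘ ⋯ ∘ L_1 ∘ P)(a)` at time `t`. -/
def eval (N : CTFNO T d da du) (σ : ℝ → ℝ) (a : Torus d → EuclideanSpace ℝ (Fin da))
    (t : Set.Icc (0 : ℝ) T) (x : Torus d) : EuclideanSpace ℝ (Fin du) :=
  WithLp.toLp 2 (N.Q *ᵥ N.state σ a t N.L x)

/-- The operator `F : H^s(𝕋^d; ℝ^da) → C([0,T]; H^s'(𝕋^d; ℝ^du))` is the network `N` with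
activation function `σ`: every state of the network is (up to null sets) a curve in
`C([0,T]; L²)`, so that the Fourier transforms in the layers make sense, and `F(a)(t)` is almost
everywhere the output of the network. -/
def Realizes (N : CTFNO T d da du) (σ : ℝ → ℝ) {s s' : ℝ}
    (F : Hs s d da → C(Set.Icc (0 : ℝ) T, Hs s' d du)) : Prop :=
  ∀ a : Hs s d da,
    (∀ k ≤ N.L, ∃ V : C(Set.Icc (0 : ℝ) T, L2 d N.n), ∀ t,
      (fun x => (V t x).ofLp) =ᵐ[torusMeasure d] N.state σ a.toL2 t k) ∧
    ∀ t, (F a t).toL2 =ᵐ[torusMeasure d] N.eval σ a.toL2 t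

end CTFNO

end TFNO

end

/-!
The approximating networks have two layers, and produce operators of the form
`F a t = ∑ j, c j • σ(ζ j a + ψ j t * g j)`, where `g j` is a plane wave placed in one component of
`ℝ^du`, `ψ j` is a continuous function of time and `ζ j` is a functional of the input. The second
layer does this if the functionals are linear combinations of averages over the torus of channels
of the first layer: such averages are zero modes, which the kernel of the second layer reads off,
while `ψ j t * g j` is the time-modulated bias. The first layer computes `σ(r ∗ a + b)`, with
filters `r` that have finitely many modes and smooth biases `b`. Two density statements are needed.

*The functionals* `a ↦ ∫ σ(r ∗ a + b)` have dense span in `C(K)` (`mem_closure_span_mean`). Since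
`σ` is not a polynomial, linear combinations of `z ↦ σ(w z + b)` approximate all continuous
functions locally uniformly, so `σ` may be replaced by `exp`. The bias `log (2 + g)` turns the
average into `∫ (2 + g) exp(r ∗ a)`, for every small plane wave `g`. A functional on `C(K)` that
annihilates these averages sends `x ↦ exp((r ∗ a)(x))` to a function of `x` all of whose Fourier
coefficients vanish; hence it also annihilates the point evaluations `a ↦ exp((r ∗ a)(0))`
(`expFilter_mem_closure`). These are closed under multiplication and separate points, and the
Stone-Weierstrass theorem applies.

*The outputs* `(a, t) ↦ σ(η(a) + ψ(t) g)` have dense span in `C(K × [0,T]; H^s')`, for `η` in a dense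
set of functions (`mem_closure_span_outElem`). As `σ` is `C^k` and not a polynomial, `z ↦ z²` is a
limit of combinations of `z ↦ σ(w z + b)` with all derivatives up to order `k`
(`exists_ridge_approx`), and the `H^s'` norm of a function on the torus is controlled by its
derivatives of order `k` in the coordinate directions (`sum_sobolevWeight_sq_le`). So
`(η + ψ g)²` is in the closed span, and by polarization `η ψ g` is. Products `η ψ` have dense span
in `C(K × [0,T])`, plane waves have dense span in `H^s'` (`mem_closure_span_waveHs`), and a
partition of unity reduces continuous maps into `H^s'` to multiples of constants.
-/

noncomputable section

namespace TFNO

open Set Filter Topology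

/-! ### Closed subspaces of function spaces -/

theorem mem_of_forall_dual_eq_zero {E : Type*} [NormedAddCommGroup E] [NormedSpace ℝ E]
    {M : Submodule ℝ E} (hM : IsClosed (M : Set E)) {x : E}
    (h : ∀ Λ : StrongDual ℝ E, (∀ y ∈ M, Λ y = 0) → Λ x = 0) : x ∈ M := by
  by_contra hx
  obtain ⟨Λ, u, hu, hΛ⟩ := geometric_hahn_banach_point_closed M.convex hM hx
  -- a functional that is bounded below on a subspace vanishes on it
  have hzero : ∀ y ∈ M, Λ y = 0 := by
    intro y hy
    by_contra hne
    have := hΛ (((u - 1) / Λ y) • y) (M.smul_mem _ hy)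
    rw [map_smul, smul_eq_mul, div_mul_cancel₀ _ hne] at this
    linarith
  have h0 := hΛ 0 M.zero_mem
  rw [map_zero] at h0
  linarith [h Λ hzero]

theorem intervalIntegral_mem {E : Type*} [NormedAddCommGroup E] [NormedSpace ℝ E] [CompleteSpace E]
    {M : Submodule ℝ E} (hM : IsClosed (M : Set E)) {γ : ℝ → E} (hγ : Continuous γ)
    (h : ∀ t, γ t ∈ M) (a b : ℝ) : ∫ t in a..b, γ t ∈ M := by
  refine mem_of_forall_dual_eq_zero hM fun Λ hΛ => ?_
  rw [← Λ.intervalIntegral_comp_comm (hγ.intervalIntegrable a b)]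
  simp [hΛ _ (h _)]

theorem intervalIntegral_continuousMap_apply {X V : Type*} [TopologicalSpace X] [CompactSpace X]
    [NormedAddCommGroup V] [NormedSpace ℝ V] [CompleteSpace V] {γ : ℝ → C(X, V)}
    (hγ : Continuous γ) (a b : ℝ) (x : X) : (∫ t in a..b, γ t) x = ∫ t in a..b, γ t x :=
  ((ContinuousMap.evalCLM ℝ x).intervalIntegral_comp_comm (hγ.intervalIntegrable a b)).symm

/-- If a family of functions, differentiable in a real parameter with a jointly continuous
derivative, stays in a closed subspace of `C(X, V)`, then so does its derivative in the
parameter. -/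
theorem deriv_param_mem {X V : Type*} [TopologicalSpace X] [CompactSpace X]
    [NormedAddCommGroup V] [NormedSpace ℝ V] [CompleteSpace V] {M : Submodule ℝ C(X, V)}
    (hM : IsClosed (M : Set C(X, V))) (G G' : C(ℝ × X, V))
    (hG : ∀ w x, HasDerivAt (fun w => G (w, x)) (G' (w, x)) w) (hmem : ∀ w, G.curry w ∈ M)
    (w : ℝ) : G'.curry w ∈ M := by
  have key : ∀ v, G.curry v = G.curry 0 + ∫ t in (0 : ℝ)..v, G'.curry t := by
    intro v
    ext x
    rw [ContinuousMap.add_apply, intervalIntegral_continuousMap_apply G'.curry.continuous]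
    simp only [ContinuousMap.curry_apply]
    rw [intervalIntegral.integral_eq_sub_of_hasDerivAt (fun t _ => hG t x)]
    · abel
    · exact (by fun_prop : Continuous fun t => G' (t, x)).intervalIntegrable _ _
  have hd : HasDerivAt (fun v => G.curry v) (G'.curry w) w := by
    have h1 : HasDerivAt (fun v => ∫ t in (0 : ℝ)..v, G'.curry t) (G'.curry w) w :=
      intervalIntegral.integral_hasDerivAt_right (G'.curry.continuous.intervalIntegrable _ _)
        (G'.curry.continuous.stronglyMeasurableAtFilter _ _) G'.curry.continuous.continuousAt
    have h2 := h1.const_add (G.curry 0)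
    exact h2.congr_of_eventuallyEq (Eventually.of_forall key)
  rw [hasDerivAt_iff_tendsto_slope] at hd
  refine hM.mem_of_tendsto hd (Eventually.of_forall fun v => ?_)
  rw [slope_def_module]
  exact M.smul_mem _ (M.sub_mem (hmem _) (hmem _))

/-- The version of `deriv_param_mem` for iterated derivatives, for functions of the form
`x ↦ G w (ι x)`. -/
theorem iteratedDeriv_param_mem {X V : Type*} [TopologicalSpace X] [CompactSpace X]
    [NormedAddCommGroup V] [NormedSpace ℝ V] [CompleteSpace V] {M : Submodule ℝ C(X, V)}
    (hM : IsClosed (M : Set C(X, V))) (ι : C(X, ℝ)) (n : ℕ) (G : ℝ → ℝ → V)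
    (hG : ContDiff ℝ n (Function.uncurry G))
    (hmem : ∀ w, ∃ g ∈ M, ∀ x, g x = G w (ι x)) (w : ℝ) :
    ∃ g ∈ M, ∀ x, g x = iteratedDeriv n (fun v => G v (ι x)) w := by
  induction n generalizing G w with
  | zero => simpa using hmem w
  | succ n ih =>
    have hG1 : ContDiff ℝ 1 (Function.uncurry G) := hG.of_le (by norm_cast; omega)
    have hd : ContDiff ℝ n (Function.uncurry fun v y => deriv (fun u => G u y) v) := by
      have h0 : ContDiff ℝ (n + 1) (Function.uncurry fun (p : ℝ × ℝ) u => G u p.2) :=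
        hG.comp (by fun_prop : ContDiff ℝ (n + 1) fun q : (ℝ × ℝ) × ℝ => (q.2, q.1.2))
      have h1 : ContDiff ℝ n fun p : ℝ × ℝ => fderiv ℝ (fun u => G u p.2) p.1 :=
        ContDiff.fderiv (f := fun (p : ℝ × ℝ) u => G u p.2) h0 contDiff_fst le_rfl
      exact h1.clm_apply (contDiff_const (c := (1 : ℝ)))
    have key := ih (fun v y => deriv (fun u => G u y) v) hd ?_ w
    · simpa only [iteratedDeriv_succ'] using key
    · intro v
      let A : C(ℝ × X, V) := ⟨fun p => G p.1 (ι p.2),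
        hG.continuous.comp (by fun_prop : Continuous fun p : ℝ × X => (p.1, ι p.2))⟩
      let B : C(ℝ × X, V) := ⟨fun p => deriv (fun u => G u (ι p.2)) p.1,
        hd.continuous.comp (by fun_prop : Continuous fun p : ℝ × X => (p.1, ι p.2))⟩
      refine ⟨B.curry v, deriv_param_mem hM A B (fun u x => ?_) (fun u => ?_) v, fun x => rfl⟩
      · have : ContDiff ℝ 1 fun u => G u (ι x) :=
          hG1.comp (by fun_prop : ContDiff ℝ 1 fun u : ℝ => (u, ι x))
        exact (this.differentiable one_ne_zero u).hasDerivAt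
      · obtain ⟨g, hg, hgx⟩ := hmem u
        convert! hg using 1
        ext x
        exact (hgx x).symm

/-! ### Functions with a vanishing derivative of some order -/

theorem eq_sum_of_iteratedDeriv_eq_zero (n : ℕ) (f : ℝ → ℝ) (hf : ContDiff ℝ n f)
    (h : ∀ x, iteratedDeriv n f x = 0) :
    ∃ c : ℕ → ℝ, ∀ x, f x = ∑ i ∈ Finset.range n, c i * x ^ i := by
  induction n generalizing f with
  | zero => exact ⟨0, fun x => by simpa using h x⟩
  | succ n ih =>
    have hf' := contDiff_succ_iff_deriv.1 (by exact_mod_cast hf : ContDiff ℝ (n + 1) f)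
    obtain ⟨c, hc⟩ := ih (deriv f) hf'.2.2 (by simpa only [iteratedDeriv_succ'] using h)
    let q : ℝ → ℝ := fun x => ∑ i ∈ Finset.range n, c i / (i + 1) * x ^ (i + 1)
    have hq : ∀ x, HasDerivAt q (deriv f x) x := by
      intro x
      rw [hc x]
      refine HasDerivAt.fun_sum fun i _ => ?_
      have := (hasDerivAt_pow (i + 1) x).const_mul (c i / (i + 1))
      convert! this using 1
      have : (i + 1 : ℝ) ≠ 0 := by positivity
      push_cast
      field_simp
    have hconst : ∀ x, f x - q x = f 0 - q 0 := fun x =>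
      is_const_of_deriv_eq_zero (f := fun y => f y - q y)
        (fun y => (hf'.1 y).sub (hq y).differentiableAt)
        (fun y => (((hf'.1 y).hasDerivAt).sub (hq y)).deriv.trans (sub_self _)) x 0
    refine ⟨fun i => if i = 0 then f 0 - q 0 else c (i - 1) / ((i - 1 : ℕ) + 1), fun x => ?_⟩
    rw [Finset.sum_range_succ', eq_add_of_sub_eq (hconst x)]
    simp [q, add_comm]

/-- Pointwise limits of polynomials of degree less than `n` are polynomials: by Lagrange
interpolation, such a polynomial is determined by its values at `0, …, n - 1`, in a continuous way. -/
theorem exists_polynomial_of_tendsto {n : ℕ} {f : ℝ → ℝ} {l : Filter ℝ} [l.NeBot]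
    {F : ℝ → ℝ → ℝ} (hF : ∀ᶠ h in l, ∃ c : ℕ → ℝ, ∀ x, F h x = ∑ i ∈ Finset.range n, c i * x ^ i)
    (hlim : ∀ x, Tendsto (fun h => F h x) l (𝓝 (f x))) : ∃ p : ℝ[X], ∀ x, f x = p.eval x := by
  let v : ℕ → ℝ := fun i => i
  have hv : Set.InjOn v (Finset.range n) := Nat.cast_injective.injOn
  refine ⟨Lagrange.interpolate (Finset.range n) v fun i => f (v i), fun x => ?_⟩
  refine tendsto_nhds_unique (hlim x) ?_
  have h1 : Tendsto (fun h => ∑ i ∈ Finset.range n,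
      F h (v i) * (Lagrange.basis (Finset.range n) v i).eval x) l
      (𝓝 (∑ i ∈ Finset.range n, f (v i) * (Lagrange.basis (Finset.range n) v i).eval x)) :=
    tendsto_finsetSum _ fun i _ => (hlim _).mul_const _
  rw [Lagrange.interpolate_apply, Polynomial.eval_finsetSum]
  simp only [eval_mul, eval_C]
  refine h1.congr' ?_
  filter_upwards [hF] with h hh
  obtain ⟨c, hc⟩ := hh
  let p : ℝ[X] := ∑ i ∈ Finset.range n, C (c i) * X ^ i
  have hp : ∀ y, F h y = p.eval y := fun y => by
    rw [hc, Polynomial.eval_finsetSum]; simp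
  have hdeg : p.degree < (Finset.range n).card := by
    rw [Finset.card_range, ← mem_degreeLT]
    refine Submodule.sum_mem _ fun i hi => mem_degreeLT.2 ?_
    exact (degree_C_mul_X_pow_le _ _).trans_lt (by exact_mod_cast Finset.mem_range.1 hi)
  rw [hp x, Lagrange.eq_interpolate hv hdeg, Lagrange.interpolate_apply,
    Polynomial.eval_finsetSum]
  simp [hp]

/-! ### Steklov averages -/

/-- The average of `g` over `[x, x + h]`. -/
def steklov (h : ℝ) (g : ℝ → ℝ) (x : ℝ) : ℝ := h⁻¹ * ∫ τ in (0 : ℝ)..h, g (x + τ)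

theorem hasDerivAt_steklov {g : ℝ → ℝ} (hg : Continuous g) (h x : ℝ) :
    HasDerivAt (steklov h g) (h⁻¹ * (g (x + h) - g x)) x := by
  have h0 : ∀ y, steklov h g y =
      h⁻¹ * ((∫ τ in (0 : ℝ)..(y + h), g τ) - ∫ τ in (0 : ℝ)..y, g τ) := by
    intro y
    rw [steklov, intervalIntegral.integral_comp_add_left, add_zero,
      intervalIntegral.integral_interval_sub_left (hg.intervalIntegrable _ _)
        (hg.intervalIntegrable _ _)]
  have h1 : ∀ y, HasDerivAt (fun u => ∫ τ in (0 : ℝ)..u, g τ) (g y) y := fun y =>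
    hg.integral_hasStrictDerivAt 0 y |>.hasDerivAt
  have h2 := (((h1 (x + h)).comp_add_const x h).sub (h1 x)).const_mul h⁻¹
  exact h2.congr_of_eventuallyEq (Eventually.of_forall h0)

theorem contDiff_steklov {g : ℝ → ℝ} {k : ℕ} (hg : ContDiff ℝ k g) (h : ℝ) :
    ContDiff ℝ (k + 1 : ℕ) (steklov h g) := by
  have hd : deriv (steklov h g) = fun x => h⁻¹ * (g (x + h) - g x) :=
    funext fun x => (hasDerivAt_steklov hg.continuous h x).deriv
  push_cast
  rw [contDiff_succ_iff_deriv, hd]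
  exact ⟨fun x => (hasDerivAt_steklov hg.continuous h x).differentiableAt, by simp, by fun_prop⟩

theorem deriv_steklov {g : ℝ → ℝ} (hg : ContDiff ℝ 1 g) (h : ℝ) :
    deriv (steklov h g) = steklov h (deriv g) := by
  funext x
  rw [(hasDerivAt_steklov hg.continuous h x).deriv, steklov,
    intervalIntegral.integral_comp_add_left, add_zero, intervalIntegral.integral_deriv_eq_sub]
  · exact fun y _ => hg.differentiable one_ne_zero y
  · exact (hg.continuous_deriv le_rfl).intervalIntegrable _ _

theorem iteratedDeriv_steklov {g : ℝ → ℝ} {k : ℕ} (hg : ContDiff ℝ k g) (h : ℝ) {j : ℕ}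
    (hj : j ≤ k) : iteratedDeriv j (steklov h g) = steklov h (iteratedDeriv j g) := by
  induction j generalizing g k with
  | zero => simp
  | succ j ih =>
    obtain ⟨k, rfl⟩ : ∃ k', k = k' + 1 := ⟨k - 1, by omega⟩
    have hg' := contDiff_succ_iff_deriv.1 (by exact_mod_cast hg : ContDiff ℝ (k + 1) g)
    rw [iteratedDeriv_succ', deriv_steklov (hg.of_le (by norm_cast; omega)),
      ih hg'.2.2 (by omega), iteratedDeriv_succ']

theorem contDiff_steklov_iterate {g : ℝ → ℝ} {k : ℕ} (hg : ContDiff ℝ k g) (h : ℝ) (n : ℕ) :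
    ContDiff ℝ (k + n : ℕ) ((steklov h)^[n] g) := by
  induction n with
  | zero => simpa using hg
  | succ n ih =>
    rw [Function.iterate_succ_apply']
    exact contDiff_steklov ih h

theorem abs_steklov_iterate_sub_le {g : ℝ → ℝ} (hg : Continuous g) {h : ℝ} (hh : 0 < h)
    (n : ℕ) {x c ε : ℝ} (hε : ∀ y ∈ Icc x (x + n * h), |g y - c| ≤ ε) :
    |(steklov h)^[n] g x - c| ≤ ε := by
  induction n generalizing x with
  | zero => simpa using hε x (by simp)
  | succ n ih =>
    have hcont : Continuous ((steklov h)^[n] g) :=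
      (contDiff_steklov_iterate (k := 0) (contDiff_zero.2 hg) h n).continuous
    rw [Function.iterate_succ_apply', steklov]
    have h1 : h⁻¹ * (∫ τ in (0 : ℝ)..h, (steklov h)^[n] g (x + τ)) - c
        = h⁻¹ * ∫ τ in (0 : ℝ)..h, ((steklov h)^[n] g (x + τ) - c) := by
      rw [intervalIntegral.integral_sub
        ((by fun_prop : Continuous fun τ => (steklov h)^[n] g (x + τ)).intervalIntegrable _ _)
        intervalIntegrable_const]
      simp
      field_simp
    rw [h1, abs_mul, abs_of_pos (inv_pos.2 hh)]
    have h2 := intervalIntegral.norm_integral_le_of_norm_le_const (a := 0) (b := h) (C := ε)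
      (f := fun τ => (steklov h)^[n] g (x + τ) - c) (fun τ hτ => by
        rw [uIoc_of_le hh.le] at hτ
        refine ih fun y hy => hε y ⟨by linarith [hy.1, hτ.1], hy.2.trans ?_⟩
        push_cast
        linarith [hτ.2])
    rw [Real.norm_eq_abs, sub_zero, abs_of_pos hh] at h2
    rw [inv_mul_le_iff₀ hh]
    linarith

theorem tendsto_steklov_iterate {g : ℝ → ℝ} (hg : Continuous g) (n : ℕ) (x : ℝ) :
    Tendsto (fun h => (steklov h)^[n] g x) (𝓝[>] 0) (𝓝 (g x)) := by
  rw [Metric.tendsto_nhds]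
  intro ε hε
  obtain ⟨δ, hδ, hδε⟩ := Metric.continuousAt_iff.1 hg.continuousAt (ε / 2) (half_pos hε)
  filter_upwards [Ioo_mem_nhdsGT (show (0 : ℝ) < δ / (n + 1) by positivity)] with h hh
  rw [Real.dist_eq]
  refine (abs_steklov_iterate_sub_le hg hh.1 n fun y hy => ?_).trans_lt (half_lt_self hε)
  have h1 : h * (n + 1) < δ := (lt_div_iff₀ (by positivity)).1 hh.2
  refine (hδε ?_).le
  rw [Real.dist_eq, abs_lt]
  constructor <;> linarith [hy.1, hy.2, hh.1]

/-- A continuous function which is not a polynomial has, for every `n`, an `n`-fold Steklov average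
whose `n`-th derivative is not identically zero: otherwise these averages, and hence their limit,
would be polynomials of degree less than `n`. -/
theorem exists_iteratedDeriv_steklov_ne_zero {σ : ℝ → ℝ} (hσ : Continuous σ)
    (hpoly : ¬ ∃ p : ℝ[X], ∀ x, σ x = p.eval x) (n : ℕ) :
    ∃ h b, iteratedDeriv n ((steklov h)^[n] σ) b ≠ 0 := by
  by_contra! hcon
  refine hpoly (exists_polynomial_of_tendsto (n := n) (Eventually.of_forall fun h => ?_)
    (tendsto_steklov_iterate hσ n))
  have := contDiff_steklov_iterate (k := 0) (contDiff_zero.2 hσ) h n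
  rw [zero_add] at this
  exact eq_sum_of_iteratedDeriv_eq_zero n _ this (hcon h)

/-! ### Density of ridge functions of one variable -/

/-- The subspace `M` of `C([-R, R]; ℝ^{k+1})` contains the `k`-jets `(g, g', …, g^{(k)})` of all
functions `g(x) = f(w x + b)`. -/
def RidgeMem {k : ℕ} {R : ℝ} (M : Submodule ℝ C(Icc (-R) R, Fin (k + 1) → ℝ)) (f : ℝ → ℝ) : Prop :=
  ∀ w b, ∃ g ∈ M, ∀ (x : Icc (-R) R) j, g x j = w ^ (j : ℕ) * iteratedDeriv j f (w * x + b)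

theorem contDiff_iteratedDeriv_of_le {f : ℝ → ℝ} {m n j : ℕ} (hf : ContDiff ℝ m f)
    (h : n + j ≤ m) : ContDiff ℝ n (iteratedDeriv j f) := by
  induction j generalizing f m with
  | zero => simpa using hf.of_le (by exact_mod_cast h)
  | succ j ih =>
    obtain ⟨m, rfl⟩ : ∃ m', m = m' + 1 := ⟨m - 1, by omega⟩
    have hf' := contDiff_succ_iff_deriv.1 (by exact_mod_cast hf : ContDiff ℝ (m + 1) f)
    rw [iteratedDeriv_succ']
    exact ih hf'.2.2 (by omega)

/-- An average of translates of `f` is a limit of linear combinations of translates. -/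
theorem RidgeMem.steklov {k : ℕ} {R : ℝ} {M : Submodule ℝ C(Icc (-R) R, Fin (k + 1) → ℝ)}
    (hM : IsClosed (M : Set C(Icc (-R) R, Fin (k + 1) → ℝ))) {f : ℝ → ℝ} (hf : ContDiff ℝ k f)
    (hmem : RidgeMem M f) (h : ℝ) : RidgeMem M (steklov h f) := by
  intro w b
  have hc : ∀ j : Fin (k + 1), Continuous (iteratedDeriv j f) := fun j =>
    hf.continuous_iteratedDeriv j (by exact_mod_cast Nat.lt_succ_iff.1 j.2)
  let Γ : C(ℝ × Icc (-R) R, Fin (k + 1) → ℝ) :=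
    ⟨fun p j => w ^ (j : ℕ) * iteratedDeriv j f (w * p.2 + b + p.1),
      continuous_pi fun j => continuous_const.mul ((hc j).comp (by fun_prop))⟩
  have hΓ : ∀ τ, Γ.curry τ ∈ M := by
    intro τ
    obtain ⟨g, hg, hgx⟩ := hmem w (b + τ)
    convert! hg using 1
    ext x j
    rw [hgx, ← add_assoc]
    rfl
  refine ⟨h⁻¹ • ∫ τ in (0 : ℝ)..h, Γ.curry τ,
    M.smul_mem _ (intervalIntegral_mem hM Γ.curry.continuous hΓ 0 h), fun x j => ?_⟩
  rw [iteratedDeriv_steklov hf h (Nat.lt_succ_iff.1 j.2), TFNO.steklov, ContinuousMap.smul_apply,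
    intervalIntegral_continuousMap_apply Γ.curry.continuous, Pi.smul_apply, smul_eq_mul]
  have h1 : (∫ τ in (0 : ℝ)..h, Γ.curry τ x) j = ∫ τ in (0 : ℝ)..h, Γ.curry τ x j :=
    ((ContinuousLinearMap.proj (R := ℝ) (φ := fun _ : Fin (k + 1) => ℝ) j).intervalIntegral_comp_comm
      ((by fun_prop : Continuous fun τ => Γ.curry τ x).intervalIntegrable 0 h)).symm
  rw [h1, mul_left_comm]
  congr 1
  rw [← intervalIntegral.integral_const_mul]
  rfl

theorem RidgeMem.steklov_iterate {k : ℕ} {R : ℝ} {M : Submodule ℝ C(Icc (-R) R, Fin (k + 1) → ℝ)}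
    (hM : IsClosed (M : Set C(Icc (-R) R, Fin (k + 1) → ℝ))) {f : ℝ → ℝ} (hf : ContDiff ℝ k f)
    (hmem : RidgeMem M f) (h : ℝ) (n : ℕ) : RidgeMem M ((TFNO.steklov h)^[n] f) := by
  induction n with
  | zero => exact hmem
  | succ n ih =>
    rw [Function.iterate_succ_apply']
    exact ih.steklov hM ((contDiff_steklov_iterate hf h n).of_le (by norm_cast; omega)) h

theorem iteratedDeriv_iteratedDeriv (m n : ℕ) (f : ℝ → ℝ) :
    iteratedDeriv m (iteratedDeriv n f) = iteratedDeriv (m + n) f := by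
  simp only [iteratedDeriv_eq_iterate, Function.iterate_add_apply]

theorem iteratedDeriv_pi_apply {J : Type*} [Fintype J] {n : ℕ} {G : ℝ → J → ℝ}
    (hG : ContDiff ℝ n G) (w : ℝ) (j : J) :
    iteratedDeriv n G w j = iteratedDeriv n (fun v => G v j) w := by
  induction n generalizing G with
  | zero => simp
  | succ n ih =>
    have hG' := contDiff_succ_iff_deriv.1 (by exact_mod_cast hG : ContDiff ℝ (n + 1) G)
    rw [iteratedDeriv_succ', iteratedDeriv_succ', ih hG'.2.2]
    congr 1
    funext v
    rw [deriv_pi fun i => differentiableAt_pi.1 (hG'.1 v) i]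

/-- The `n`-th derivative of `w ↦ f(w x + b)` at `w = 0` is `f^{(n)}(b) x^n`. -/
theorem RidgeMem.exists_pow {k n : ℕ} {R : ℝ} {M : Submodule ℝ C(Icc (-R) R, Fin (k + 1) → ℝ)}
    (hM : IsClosed (M : Set C(Icc (-R) R, Fin (k + 1) → ℝ))) {f : ℝ → ℝ}
    (hf : ContDiff ℝ (k + n : ℕ) f) (hmem : RidgeMem M f) (b : ℝ) :
    ∃ g ∈ M, ∀ (x : Icc (-R) R) j,
      g x j = iteratedDeriv n f b * iteratedDeriv j (fun y : ℝ => y ^ n) x := by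
  have hj : ∀ j : Fin (k + 1), ContDiff ℝ n (iteratedDeriv j f) := fun j =>
    contDiff_iteratedDeriv_of_le hf (by omega)
  let G : ℝ → ℝ → Fin (k + 1) → ℝ := fun w x j => w ^ (j : ℕ) * iteratedDeriv j f (w * x + b)
  have hG : ContDiff ℝ n (Function.uncurry G) :=
    contDiff_pi.2 fun j => by
      have := hj j
      have h2 : ContDiff ℝ n fun p : ℝ × ℝ => p.1 * p.2 + b := by fun_prop
      exact (contDiff_fst.pow _).mul (this.comp h2)
  obtain ⟨g, hg, hgx⟩ := iteratedDeriv_param_mem hM ⟨Subtype.val, continuous_subtype_val⟩ n G hG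
    (fun w => (hmem w b).imp fun g hg => ⟨hg.1, fun x => funext (hg.2 x)⟩) 0
  refine ⟨g, hg, fun x j => ?_⟩
  rw [hgx]
  have hline : ContDiff ℝ n fun v => G v x :=
    hG.comp (by fun_prop : ContDiff ℝ n fun v : ℝ => (v, (x : ℝ)))
  have hcomp : ContDiff ℝ n fun v : ℝ => iteratedDeriv j f (v * x + b) :=
    (hj j).comp (by fun_prop)
  have h2 : ∀ i ≤ n, iteratedDeriv i (fun v : ℝ => iteratedDeriv j f (v * x + b)) 0
      = (x : ℝ) ^ i * iteratedDeriv (i + j) f b := by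
    intro i hi
    have := iteratedDeriv_comp_const_mul (n := i) (f := fun z => iteratedDeriv j f (z + b))
      (((hj j).of_le (by exact_mod_cast hi)).comp (by fun_prop)) (x : ℝ)
    rw [iteratedDeriv_comp_add_const, iteratedDeriv_iteratedDeriv] at this
    simpa [mul_comm] using congrFun this 0
  have h3 : iteratedDeriv n (fun v => G v x j) 0 = ∑ i ∈ .range (n + 1),
      n.choose i * iteratedDeriv i (fun v : ℝ => v ^ (j : ℕ)) 0 *
        iteratedDeriv (n - i) (fun v : ℝ => iteratedDeriv j f (v * x + b)) 0 :=
    iteratedDeriv_mul (f := fun v : ℝ => v ^ (j : ℕ)) (by fun_prop) hcomp.contDiffAt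
  refine (iteratedDeriv_pi_apply hline 0 j).trans ?_
  rw [h3, iteratedDeriv_pow]
  simp only [iteratedDeriv_fun_pow_zero]
  rcases le_or_gt (j : ℕ) n with hjn | hjn
  · rw [Finset.sum_eq_single (j : ℕ) (fun i _ hi => by simp [hi])
      (fun hn => absurd (Finset.mem_range.2 (Nat.lt_succ_of_le hjn)) hn),
      h2 _ (Nat.sub_le _ _), Nat.sub_add_cancel hjn, Nat.descFactorial_eq_factorial_mul_choose]
    push_cast
    rw [if_pos rfl]
    ring
  · rw [Nat.descFactorial_eq_zero_iff_lt.2 hjn]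
    refine (Finset.sum_eq_zero fun i hi => ?_).trans (by simp)
    rw [if_neg (by have := Finset.mem_range.1 hi; omega)]
    simp

theorem contDiff_polynomial_eval (p : ℝ[X]) (n : WithTop ℕ∞) : ContDiff ℝ n fun x => p.eval x := by
  have := p.contDiff_aeval (R := ℝ) (𝕜 := ℝ) n
  simp only [coe_aeval_eq_eval] at this
  exact this

/-- All polynomials are in the closed span of the functions `σ(w x + b)`: the averages of `σ` are
smooth enough to differentiate `n` times in `w`, in the `C^k` norm, which yields the monomials. -/
theorem RidgeMem.exists_eval {k : ℕ} {R : ℝ} {M : Submodule ℝ C(Icc (-R) R, Fin (k + 1) → ℝ)}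
    (hM : IsClosed (M : Set C(Icc (-R) R, Fin (k + 1) → ℝ))) {σ : ℝ → ℝ} (hσ : ContDiff ℝ k σ)
    (hpoly : ¬ ∃ p : ℝ[X], ∀ x, σ x = p.eval x) (hσM : RidgeMem M σ) (p : ℝ[X]) :
    ∃ g ∈ M, ∀ (x : Icc (-R) R) j, g x j = iteratedDeriv j (fun y : ℝ => p.eval y) x := by
  have hpow : ∀ n, ∃ g ∈ M, ∀ (x : Icc (-R) R) j,
      g x j = iteratedDeriv j (fun y : ℝ => y ^ n) x := by
    intro n
    obtain ⟨h, b, hne⟩ := exists_iteratedDeriv_steklov_ne_zero hσ.continuous hpoly n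
    obtain ⟨g, hg, hgx⟩ := (hσM.steklov_iterate hM hσ h n).exists_pow hM
      (contDiff_steklov_iterate hσ h n) b
    refine ⟨_, M.smul_mem (iteratedDeriv n ((TFNO.steklov h)^[n] σ) b)⁻¹ hg, fun x j => ?_⟩
    rw [ContinuousMap.smul_apply, Pi.smul_apply, hgx, smul_eq_mul, inv_mul_cancel_left₀ hne]
  induction p using Polynomial.induction_on' with
  | add p q hp hq =>
    obtain ⟨g, hg, hgx⟩ := hp
    obtain ⟨h, hh, hhx⟩ := hq
    refine ⟨_, M.add_mem hg hh, fun x j => ?_⟩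
    simp only [eval_add]
    rw [ContinuousMap.add_apply, Pi.add_apply, hgx, hhx]
    exact (iteratedDeriv_add (f := fun y => p.eval y) (g := fun y => q.eval y)
      (contDiff_polynomial_eval p _).contDiffAt (contDiff_polynomial_eval q _).contDiffAt).symm
  | monomial n a =>
    obtain ⟨g, hg, hgx⟩ := hpow n
    refine ⟨_, M.smul_mem a hg, fun x j => ?_⟩
    simp only [eval_monomial]
    rw [ContinuousMap.smul_apply, Pi.smul_apply, hgx, smul_eq_mul, iteratedDeriv_const_mul_field]

theorem iteratedDeriv_sum_ridge {k j m : ℕ} {σ f : ℝ → ℝ} (hσ : ContDiff ℝ k σ)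
    (hf : ContDiff ℝ k f) (hj : j ≤ k) (c w b : Fin m → ℝ) (x : ℝ) :
    iteratedDeriv j (fun z => f z - ∑ i, c i * σ (w i * z + b i)) x = iteratedDeriv j f x
      - ∑ i, c i * (w i ^ j * iteratedDeriv j σ (w i * x + b i)) := by
  have hσi : ∀ i, ContDiff ℝ j fun z => c i * σ (w i * z + b i) := fun i =>
    contDiff_const.mul ((hσ.of_le (by exact_mod_cast hj)).comp (by fun_prop))
  have h1 : iteratedDeriv j (fun z => f z - ∑ i, c i * σ (w i * z + b i)) x
      = iteratedDeriv j f x - iteratedDeriv j (fun z => ∑ i, c i * σ (w i * z + b i)) x :=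
    iteratedDeriv_sub (f := f) (hf.of_le (by exact_mod_cast hj)).contDiffAt
      (ContDiff.sum fun i _ => hσi i).contDiffAt
  rw [h1, iteratedDeriv_fun_sum fun i _ => (hσi i).contDiffAt]
  congr 1
  refine Finset.sum_congr rfl fun i _ => ?_
  have := iteratedDeriv_comp_const_mul (n := j) (f := fun z => σ (z + b i))
    ((hσ.of_le (by exact_mod_cast hj)).comp (by fun_prop)) (w i)
  rw [iteratedDeriv_comp_add_const] at this
  rw [iteratedDeriv_const_mul_field, this]

/-- Univariate universal approximation in `C^k([-R, R])`: every polynomial is a limit of linear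
combinations of the functions `z ↦ σ(w z + b)`, together with its derivatives up to order `k`. -/
theorem exists_ridge_approx {k : ℕ} {σ : ℝ → ℝ} (hσ : ContDiff ℝ k σ)
    (hpoly : ¬ ∃ p : ℝ[X], ∀ x, σ x = p.eval x) (p : ℝ[X]) (R : ℝ) {ε : ℝ} (hε : 0 < ε) :
    ∃ (m : ℕ) (c w b : Fin m → ℝ), ∀ j ≤ k, ∀ x ∈ Icc (-R) R,
      |iteratedDeriv j (fun z => p.eval z - ∑ i, c i * σ (w i * z + b i)) x| < ε := by
  have hc : ∀ j : Fin (k + 1), Continuous (iteratedDeriv j σ) := fun j =>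
    hσ.continuous_iteratedDeriv j (by exact_mod_cast Nat.lt_succ_iff.1 j.2)
  obtain ⟨J, hJ⟩ : ∃ J : ℝ × ℝ → C(Icc (-R) R, Fin (k + 1) → ℝ), ∀ q x j,
      J q x j = q.1 ^ (j : ℕ) * iteratedDeriv j σ (q.1 * x + q.2) :=
    ⟨fun q => ⟨fun x j => q.1 ^ (j : ℕ) * iteratedDeriv j σ (q.1 * x + q.2),
      continuous_pi fun j => continuous_const.mul ((hc j).comp (by fun_prop))⟩,
      fun _ _ _ => rfl⟩
  obtain ⟨g, hg, hgx⟩ := RidgeMem.exists_eval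
    (M := (Submodule.span ℝ (range J)).topologicalClosure)
    (Submodule.isClosed_topologicalClosure _) hσ hpoly
    (fun w b => ⟨J (w, b), Submodule.le_topologicalClosure _
      (Submodule.subset_span (mem_range_self _)), hJ (w, b)⟩) p
  obtain ⟨h, hh, hdist⟩ := Metric.mem_closure_iff.1 hg ε hε
  obtain ⟨m, c, q, rfl⟩ := Submodule.mem_span_set'.1 hh
  choose wb hwb using fun i => (q i).2
  refine ⟨m, c, fun i => (wb i).1, fun i => (wb i).2, fun j hj x hx => ?_⟩
  rw [iteratedDeriv_sum_ridge hσ (contDiff_polynomial_eval p _) hj]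
  have h3 := (dist_pi_lt_iff hε).1 ((ContinuousMap.dist_lt_iff hε).1 hdist ⟨x, hx⟩)
    ⟨j, Nat.lt_succ_of_le hj⟩
  rw [Real.dist_eq, hgx, ContinuousMap.sum_apply, Finset.sum_apply] at h3
  simpa only [ContinuousMap.smul_apply, Pi.smul_apply, ← hwb, smul_eq_mul, hJ] using h3

/-! ### Fourier coefficients of continuous functions -/

instance (d : ℕ) : (torusMeasure d).IsAddHaarMeasure := by
  unfold torusMeasure; infer_instance

theorem mFourierCoeff_eq {d : ℕ} (f : Torus d → ℂ) (ξ : Fin d → ℤ) :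
    UnitAddTorus.mFourierCoeff f ξ = ∫ x, UnitAddTorus.mFourier (-ξ) x * f x ∂torusMeasure d := rfl

theorem fourierCoeffReal_eq {d : ℕ} (f : Torus d → ℝ) (ξ : Fin d → ℤ) :
    fourierCoeffReal f ξ = ∫ x, UnitAddTorus.mFourier (-ξ) x * f x ∂torusMeasure d := rfl

theorem norm_mFourier_apply {d : ℕ} (ξ : Fin d → ℤ) (x : Torus d) :
    ‖UnitAddTorus.mFourier ξ x‖ = 1 := by
  simp only [UnitAddTorus.mFourier, ContinuousMap.coe_mk, norm_prod, fourier_apply,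
    Circle.norm_coe, Finset.prod_const_one]

theorem mFourier_apply_add {d : ℕ} (ξ : Fin d → ℤ) (x y : Torus d) :
    UnitAddTorus.mFourier ξ (x + y) = UnitAddTorus.mFourier ξ x * UnitAddTorus.mFourier ξ y := by
  simp only [UnitAddTorus.mFourier, ContinuousMap.coe_mk, ← Finset.prod_mul_distrib]
  refine Finset.prod_congr rfl fun i _ => ?_
  simp only [fourier_apply, Pi.add_apply, smul_add, AddCircle.toCircle_add, Circle.coe_mul]

theorem mFourier_apply_single {d : ℕ} (ξ : Fin d → ℤ) (i : Fin d) (h : ℝ) :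
    UnitAddTorus.mFourier ξ (Pi.single i (h : UnitAddCircle))
      = Complex.exp ((2 * Real.pi * ξ i * h : ℝ) * Complex.I) := by
  simp only [UnitAddTorus.mFourier, ContinuousMap.coe_mk]
  rw [Finset.prod_eq_single i (fun j _ hj => by simp [Pi.single_eq_of_ne hj]) (by simp),
    Pi.single_eq_same, fourier_coe_apply]
  congr 1
  push_cast
  ring

theorem mFourier_apply_zero {d : ℕ} (ξ : Fin d → ℤ) :
    UnitAddTorus.mFourier ξ (0 : Torus d) = 1 := by
  simp [UnitAddTorus.mFourier]

theorem integral_mFourier {d : ℕ} (ξ : Fin d → ℤ) :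
    ∫ x, UnitAddTorus.mFourier ξ x ∂torusMeasure d = if ξ = 0 then 1 else 0 := by
  have h := (orthonormal_iff_ite.1 (UnitAddTorus.orthonormal_mFourier (d := Fin d))) 0 ξ
  rw [L2.inner_def] at h
  rw [eq_comm] at h
  simp only [eq_comm (a := ξ)]
  refine Eq.trans ?_ h.symm
  refine integral_congr_ae ?_
  filter_upwards [UnitAddTorus.coeFn_mFourierLp 2 (0 : Fin d → ℤ),
    UnitAddTorus.coeFn_mFourierLp 2 ξ] with x hx hx'
  rw [hx, hx']
  simp [UnitAddTorus.mFourier_zero]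

theorem continuous_integrable_torus {d : ℕ} {E : Type*} [NormedAddCommGroup E]
    {f : Torus d → E} (hf : Continuous f) : Integrable f (torusMeasure d) := by
  exact hf.integrable_of_hasCompactSupport (HasCompactSupport.of_compactSpace f)

/-- Bessel's inequality, in terms of the sup norm. -/
theorem sum_sq_fourierCoeffReal_le {d : ℕ} (u : C(Torus d, ℝ)) {B : ℝ} (hB : ∀ x, |u x| ≤ B)
    (S : Finset (Fin d → ℤ)) : ∑ ξ ∈ S, ‖fourierCoeffReal u ξ‖ ^ 2 ≤ B ^ 2 := by
  let v : C(Torus d, ℂ) := ⟨fun x => (u x : ℂ), by fun_prop⟩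
  have h := UnitAddTorus.hasSum_sq_mFourierCoeff (v.toLp 2 (torusMeasure d) ℂ)
  have h1 : ∀ ξ, UnitAddTorus.mFourierCoeff (v.toLp 2 (torusMeasure d) ℂ) ξ
      = fourierCoeffReal u ξ := fun ξ => UnitAddTorus.mFourierCoeff_toLp v ξ
  have h' : HasSum (fun ξ => ‖fourierCoeffReal u ξ‖ ^ 2)
      (∫ x, ‖v.toLp 2 (torusMeasure d) ℂ x‖ ^ 2 ∂torusMeasure d) :=
    HasSum.congr_fun h fun ξ => congrArg (‖·‖ ^ 2) (h1 ξ).symm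
  refine (sum_le_hasSum S (fun _ _ => by positivity) h').trans ?_
  have h2 : ∫ x, ‖v.toLp 2 (torusMeasure d) ℂ x‖ ^ 2 ∂torusMeasure d
      = ∫ x, ‖u x‖ ^ 2 ∂torusMeasure d := by
    refine integral_congr_ae ?_
    filter_upwards [v.coeFn_toLp (p := 2) (𝕜 := ℂ) (torusMeasure d)] with x hx
    rw [hx]
    simp [v]
  refine h2.le.trans ?_
  have h3 : ∫ x, ‖u x‖ ^ 2 ∂torusMeasure d ≤ ∫ _, B ^ 2 ∂torusMeasure d := by
    refine integral_mono (continuous_integrable_torus (by fun_prop)) (integrable_const _) fun x => ?_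
    exact pow_le_pow_left₀ (norm_nonneg _) (hB x) 2
  simpa using h3

/-- The forward difference with step `h` in the `i`-th coordinate direction. -/
def torusDiff {d : ℕ} (i : Fin d) (h : ℝ) (u : C(Torus d, ℝ)) : C(Torus d, ℝ) :=
  ⟨fun x => u (x + Pi.single i (h : UnitAddCircle)) - u x, by fun_prop⟩

theorem fourierCoeffReal_torusDiff {d : ℕ} (i : Fin d) (h : ℝ) (u : C(Torus d, ℝ))
    (ξ : Fin d → ℤ) : fourierCoeffReal (torusDiff i h u) ξ
      = (Complex.exp ((2 * Real.pi * ξ i * h : ℝ) * Complex.I) - 1) * fourierCoeffReal u ξ := by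
  rw [sub_mul, one_mul, fourierCoeffReal_eq, fourierCoeffReal_eq]
  have h1 : (∫ x, UnitAddTorus.mFourier (-ξ) x * (u x : ℂ) ∂torusMeasure d)
      = ∫ x, UnitAddTorus.mFourier (-ξ) (x + Pi.single i (h : UnitAddCircle))
        * (u (x + Pi.single i (h : UnitAddCircle)) : ℂ) ∂torusMeasure d :=
    (integral_add_right_eq_self (μ := torusMeasure d)
      (fun x => UnitAddTorus.mFourier (-ξ) x * (u x : ℂ)) _).symm
  have h2 : (∫ x, UnitAddTorus.mFourier (-ξ) x
        * (u (x + Pi.single i (h : UnitAddCircle)) : ℂ) ∂torusMeasure d)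
      = Complex.exp ((2 * Real.pi * ξ i * h : ℝ) * Complex.I)
        * ∫ x, UnitAddTorus.mFourier (-ξ) x * (u x : ℂ) ∂torusMeasure d := by
    rw [h1, ← integral_const_mul]
    congr 1
    funext x
    rw [mFourier_apply_add, mFourier_apply_single, mul_left_comm, mul_assoc,
      mul_left_comm (Complex.exp _) (Complex.exp _), ← mul_assoc (Complex.exp _) (Complex.exp _),
      ← Complex.exp_add]
    simp
  rw [← h2, ← integral_sub (continuous_integrable_torus (by fun_prop))
    (continuous_integrable_torus (by fun_prop))]
  congr 1
  funext x
  simp only [torusDiff, ContinuousMap.coe_mk, Complex.ofReal_sub, mul_sub]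

theorem fourierCoeffReal_torusDiff_iterate {d : ℕ} (i : Fin d) (h : ℝ) (u : C(Torus d, ℝ))
    (ξ : Fin d → ℤ) (k : ℕ) : fourierCoeffReal ((torusDiff i h)^[k] u) ξ
      = (Complex.exp ((2 * Real.pi * ξ i * h : ℝ) * Complex.I) - 1) ^ k * fourierCoeffReal u ξ := by
  induction k with
  | zero => simp
  | succ k ih => rw [Function.iterate_succ_apply', fourierCoeffReal_torusDiff, ih, pow_succ]; ring

/-- The restriction of `u` to the line through `x` in the `i`-th coordinate direction. -/
def torusLine {d : ℕ} (u : C(Torus d, ℝ)) (i : Fin d) (x : Torus d) (s : ℝ) : ℝ :=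
  u (x + Pi.single i (s : UnitAddCircle))

theorem abs_torusDiff_iterate_le {d : ℕ} (i : Fin d) {h : ℝ} (hh : 0 ≤ h) (k : ℕ)
    (u : C(Torus d, ℝ)) (hu : ∀ x, ContDiff ℝ k (torusLine u i x)) {B : ℝ}
    (hB : ∀ x s, |iteratedDeriv k (torusLine u i x) s| ≤ B) (x : Torus d) :
    |(torusDiff i h)^[k] u x| ≤ h ^ k * B := by
  induction k generalizing u B with
  | zero => simpa [torusLine] using hB x 0
  | succ k ih =>
    have hline : ∀ x, torusLine (torusDiff i h u) i x
        = fun s => torusLine u i x (s + h) - torusLine u i x s := by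
      intro x
      funext s
      simp only [torusLine, torusDiff, ContinuousMap.coe_mk, add_assoc, AddCircle.coe_add,
        Pi.single_add]
    have hu' : ∀ x, ContDiff ℝ k (torusLine u i x) := fun x => (hu x).of_le (by norm_cast; omega)
    rw [Function.iterate_succ_apply]
    refine (ih (torusDiff i h u) (fun x => ?_) (B := h * B) (fun x s => ?_)).trans_eq (by ring)
    · rw [hline]
      exact ((hu' x).comp (by fun_prop)).sub (hu' x)
    · rw [hline]
      have h1 : iteratedDeriv k (fun s => torusLine u i x (s + h) - torusLine u i x s) s
          = iteratedDeriv k (torusLine u i x) (s + h) - iteratedDeriv k (torusLine u i x) s := by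
        have := iteratedDeriv_sub (n := k) (x := s) (f := fun s => torusLine u i x (s + h))
          (g := torusLine u i x) ((hu' x).comp (by fun_prop)).contDiffAt (hu' x).contDiffAt
        rw [iteratedDeriv_comp_add_const] at this
        exact this
      rw [h1]
      have h2 := Convex.norm_image_sub_le_of_norm_deriv_le (𝕜 := ℝ)
        (f := iteratedDeriv k (torusLine u i x)) (C := B) (s := univ) (x := s) (y := s + h)
        (fun y _ => ((hu x).differentiable_iteratedDeriv k (by norm_cast; omega)) y)
        (fun y _ => by rw [← iteratedDeriv_succ]; exact hB x y) convex_univ (mem_univ _)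
        (mem_univ _)
      rw [add_sub_cancel_left, Real.norm_eq_abs, Real.norm_eq_abs, abs_of_nonneg hh] at h2
      linarith

/-- Bessel's inequality for the `k`-fold difference quotients of `u`, in the limit of vanishing
step. -/
theorem sum_pow_mul_sq_fourierCoeffReal_le {d : ℕ} (i : Fin d) (k : ℕ)
    (u : C(Torus d, ℝ)) (hu : ∀ x, ContDiff ℝ k (torusLine u i x)) {B : ℝ}
    (hB : ∀ x s, |iteratedDeriv k (torusLine u i x) s| ≤ B) (S : Finset (Fin d → ℤ)) :
    ∑ ξ ∈ S, ((ξ i : ℝ) ^ 2) ^ k * ‖fourierCoeffReal u ξ‖ ^ 2 ≤ B ^ 2 := by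
  have hlim : ∀ q : ℝ, Tendsto (fun h : ℝ => ‖Complex.exp ((q * h : ℝ) * Complex.I) - 1‖ / h)
      (𝓝[>] 0) (𝓝 |q|) := by
    intro q
    have hd : HasDerivAt (fun h : ℝ => Complex.exp ((q * h : ℝ) * Complex.I)) (q * Complex.I) 0 := by
      have h1 : HasDerivAt (fun h : ℝ => ((q * h : ℝ) : ℂ) * Complex.I) (q * Complex.I) 0 := by
        have := ((hasDerivAt_id (0 : ℝ)).const_mul q).ofReal_comp.mul_const Complex.I
        simpa using this
      simpa using h1.cexp
    have h2 := hd.tendsto_slope_zero_right.norm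
    simp only [norm_mul, Complex.norm_real, Complex.norm_I, mul_one, Real.norm_eq_abs] at h2
    refine h2.congr' ?_
    filter_upwards [self_mem_nhdsWithin] with h hh
    have hh' : (0 : ℝ) < h := hh
    rw [norm_smul, norm_inv, Real.norm_of_nonneg hh'.le, div_eq_inv_mul]
    simp
  have hlim2 : Tendsto (fun h : ℝ => ∑ ξ ∈ S,
      (‖Complex.exp ((2 * Real.pi * ξ i * h : ℝ) * Complex.I) - 1‖ / h) ^ (2 * k)
        * ‖fourierCoeffReal u ξ‖ ^ 2) (𝓝[>] 0)
      (𝓝 (∑ ξ ∈ S, |2 * Real.pi * ξ i| ^ (2 * k) * ‖fourierCoeffReal u ξ‖ ^ 2)) :=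
    tendsto_finsetSum _ fun ξ _ => ((hlim _).pow _).mul_const _
  have hle : ∑ ξ ∈ S, |2 * Real.pi * ξ i| ^ (2 * k) * ‖fourierCoeffReal u ξ‖ ^ 2 ≤ B ^ 2 := by
    refine le_of_tendsto hlim2 ?_
    filter_upwards [self_mem_nhdsWithin] with h hh
    have hh' : (0 : ℝ) < h := hh
    have h1 := sum_sq_fourierCoeffReal_le ((torusDiff i h)^[k] u)
      (abs_torusDiff_iterate_le i hh'.le k u hu hB) S
    simp only [fourierCoeffReal_torusDiff_iterate, norm_mul, norm_pow] at h1
    have h2 : ∀ ξ : Fin d → ℤ,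
        (‖Complex.exp ((2 * Real.pi * ξ i * h : ℝ) * Complex.I) - 1‖ / h) ^ (2 * k)
          * ‖fourierCoeffReal u ξ‖ ^ 2
        = (‖Complex.exp ((2 * Real.pi * ξ i * h : ℝ) * Complex.I) - 1‖ ^ k
          * ‖fourierCoeffReal u ξ‖) ^ 2 / h ^ (2 * k) := by
      intro ξ
      rw [div_pow, mul_pow, ← pow_mul, mul_comm k 2]
      ring
    simp only [h2]
    rw [← Finset.sum_div, div_le_iff₀ (by positivity)]
    refine h1.trans_eq ?_
    ring
  refine (Finset.sum_le_sum fun ξ _ => ?_).trans hle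
  refine mul_le_mul_of_nonneg_right ?_ (by positivity)
  rw [pow_mul]
  refine pow_le_pow_left₀ (by positivity) ?_ k
  rw [sq_abs, mul_pow]
  have : (1 : ℝ) ≤ (2 * Real.pi) ^ 2 := by nlinarith [Real.pi_gt_three]
  nlinarith [sq_nonneg (ξ i : ℝ)]

theorem one_add_sum_sq_rpow_le {d k : ℕ} {s : ℝ} (hs : s ≤ k) (ξ : Fin d → ℤ) :
    (1 + ∑ i, (ξ i : ℝ) ^ 2) ^ s ≤ (d + 1) ^ k * (1 + ∑ i, ((ξ i : ℝ) ^ 2) ^ k) := by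
  have h1 : (1 : ℝ) ≤ 1 + ∑ i, (ξ i : ℝ) ^ 2 := by
    have : 0 ≤ ∑ i, (ξ i : ℝ) ^ 2 := Finset.sum_nonneg fun _ _ => sq_nonneg _
    linarith
  refine (Real.rpow_le_rpow_of_exponent_le h1 hs).trans ?_
  rw [Real.rpow_natCast]
  rcases k with _ | k
  · simp
  have h2 := pow_sum_div_card_le_sum_pow (s := (Finset.univ : Finset (Option (Fin d))))
    (f := fun o => o.elim 1 fun i => (ξ i : ℝ) ^ 2)
    (fun o _ => by cases o <;> simp [sq_nonneg]) k
  simp only [Fintype.sum_option, Option.elim_none, Option.elim_some, Finset.card_univ,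
    Fintype.card_option, Fintype.card_fin, one_pow] at h2
  rw [div_le_iff₀ (by positivity)] at h2
  refine h2.trans ?_
  rw [mul_comm]
  push_cast
  refine mul_le_mul_of_nonneg_right ?_ (by positivity)
  exact pow_le_pow_right₀ (by linarith [(Nat.cast_nonneg d : (0 : ℝ) ≤ d)]) (Nat.le_succ k)

/-- The Sobolev norm of order `s ≤ k` is controlled by the sup norms of a function and of its pure
partial derivatives of order `k`. -/
theorem sum_sobolevWeight_sq_le {d k : ℕ} {s : ℝ} (hs : s ≤ k) (u : C(Torus d, ℝ))
    (hu : ∀ i x, ContDiff ℝ k (torusLine u i x)) {B : ℝ} (hB0 : ∀ x, |u x| ≤ B)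
    (hB : ∀ i x t, |iteratedDeriv k (torusLine u i x) t| ≤ B) (S : Finset (Fin d → ℤ)) :
    ∑ ξ ∈ S, (sobolevWeight s ξ * ‖fourierCoeffReal u ξ‖) ^ 2 ≤ ((d + 1) ^ (k + 1) * B) ^ 2 := by
  have hw : ∀ ξ : Fin d → ℤ, sobolevWeight s ξ ^ 2 = (1 + ∑ i, (ξ i : ℝ) ^ 2) ^ s := by
    intro ξ
    rw [sobolevWeight, ← Real.rpow_natCast, ← Real.rpow_mul (by positivity)]
    congr 1
    push_cast; ring
  calc ∑ ξ ∈ S, (sobolevWeight s ξ * ‖fourierCoeffReal u ξ‖) ^ 2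
      ≤ ∑ ξ ∈ S, (d + 1) ^ k * (‖fourierCoeffReal u ξ‖ ^ 2
          + ∑ i, ((ξ i : ℝ) ^ 2) ^ k * ‖fourierCoeffReal u ξ‖ ^ 2) := by
        refine Finset.sum_le_sum fun ξ _ => ?_
        rw [mul_pow, hw, ← Finset.sum_mul, ← one_add_mul, ← mul_assoc]
        exact mul_le_mul_of_nonneg_right (one_add_sum_sq_rpow_le hs ξ) (by positivity)
    _ = (d + 1) ^ k * (∑ ξ ∈ S, ‖fourierCoeffReal u ξ‖ ^ 2
          + ∑ i, ∑ ξ ∈ S, ((ξ i : ℝ) ^ 2) ^ k * ‖fourierCoeffReal u ξ‖ ^ 2) := by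
        rw [← Finset.mul_sum, Finset.sum_add_distrib, Finset.sum_comm]
    _ ≤ (d + 1) ^ k * (B ^ 2 + ∑ _i : Fin d, B ^ 2) := by
        gcongr with i
        · exact sum_sq_fourierCoeffReal_le u hB0 S
        · exact sum_pow_mul_sq_fourierCoeffReal_le i k u (hu i) (hB i) S
    _ = (d + 1) ^ (k + 1) * B ^ 2 := by
        simp only [Finset.sum_const, Finset.card_univ, Fintype.card_fin, nsmul_eq_mul]
        ring
    _ ≤ ((d + 1) ^ (k + 1) * B) ^ 2 := by
        rw [mul_pow]
        refine mul_le_mul_of_nonneg_right ?_ (sq_nonneg B)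
        have : (1 : ℝ) ≤ (d + 1 : ℝ) ^ (k + 1) :=
          one_le_pow₀ (by linarith [(Nat.cast_nonneg d : (0 : ℝ) ≤ d)])
        nlinarith

/-! ### Smooth functions as elements of the Sobolev space -/

/-- The function `u` placed in the `i`-th component, as an element of `L²(𝕋^d; ℝ^m)`. -/
def compL2 {d : ℕ} {m : ℕ} (i : Fin m) : C(Torus d, ℝ) →L[ℝ] L2 d m :=
  (ContinuousMap.toLp (E := EuclideanSpace ℝ (Fin m)) 2 (torusMeasure d) ℝ).comp
    ((ContinuousLinearMap.toSpanSingleton ℝ (EuclideanSpace.single i (1 : ℝ))).compLeftContinuous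
      ℝ (Torus d))

theorem coeFn_compL2 {d m : ℕ} (i : Fin m) (u : C(Torus d, ℝ)) :
    compL2 i u =ᵐ[torusMeasure d] fun x => u x • EuclideanSpace.single i (1 : ℝ) :=
  ContinuousMap.coeFn_toLp (p := 2) (𝕜 := ℝ) (torusMeasure d) _

theorem weightedCoeff_compL2 {d m : ℕ} (s : ℝ) (i : Fin m) (u : C(Torus d, ℝ))
    (p : (Fin d → ℤ) × Fin m) : weightedCoeff s (compL2 i u) p
      = if p.2 = i then sobolevWeight s p.1 * fourierCoeffReal u p.1 else 0 := by
  have h : fourierCoeffReal (fun x => compL2 i u x p.2) p.1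
      = fourierCoeffReal (fun x => u x * if p.2 = i then 1 else 0) p.1 := by
    rw [fourierCoeffReal_eq, fourierCoeffReal_eq]
    refine integral_congr_ae ?_
    filter_upwards [coeFn_compL2 i u] with x hx
    rw [hx]
    simp [PiLp.smul_apply]
  rw [weightedCoeff, h]
  split_ifs
  · simp
  · simp [fourierCoeffReal_eq]

/-- The functions on the torus whose restrictions to all coordinate lines are `C^k`, with a
uniformly bounded `k`-th derivative. -/
def ckTorus (d k : ℕ) : Submodule ℝ C(Torus d, ℝ) where
  carrier := {u | (∀ i x, ContDiff ℝ k (torusLine u i x)) ∧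
    ∃ B, ∀ i x t, |iteratedDeriv k (torusLine u i x) t| ≤ B}
  zero_mem' := by
    refine ⟨fun i x => contDiff_const (c := (0 : ℝ)), 0, fun i x t => ?_⟩
    have : torusLine (0 : C(Torus d, ℝ)) i x = 0 := rfl
    simp [this]
  add_mem' := by
    rintro u v ⟨hu, B, hB⟩ ⟨hv, B', hB'⟩
    refine ⟨fun i x => (hu i x).add (hv i x), B + B', fun i x t => ?_⟩
    have : torusLine (u + v) i x = torusLine u i x + torusLine v i x := rfl
    rw [this, iteratedDeriv_add (hu i x).contDiffAt (hv i x).contDiffAt]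
    exact (abs_add_le _ _).trans (add_le_add (hB i x t) (hB' i x t))
  smul_mem' := by
    rintro c u ⟨hu, B, hB⟩
    refine ⟨fun i x => contDiff_const.mul (hu i x), |c| * B, fun i x t => ?_⟩
    have : torusLine (c • u) i x = fun s => c * torusLine u i x s := rfl
    rw [this, iteratedDeriv_const_mul_field, abs_mul]
    exact mul_le_mul_of_nonneg_left (hB i x t) (abs_nonneg c)

theorem sum_weightedCoeff_compL2_le {d m k : ℕ} {s : ℝ} (hs : s ≤ k) (i : Fin m)
    (u : C(Torus d, ℝ)) (hu : ∀ i x, ContDiff ℝ k (torusLine u i x)) {B : ℝ}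
    (hB0 : ∀ x, |u x| ≤ B) (hB : ∀ i x t, |iteratedDeriv k (torusLine u i x) t| ≤ B)
    (S : Finset ((Fin d → ℤ) × Fin m)) :
    ∑ p ∈ S, ‖weightedCoeff s (compL2 i u) p‖ ^ (2 : ℝ≥0∞).toReal
      ≤ ((d + 1) ^ (k + 1) * B) ^ (2 : ℝ≥0∞).toReal := by
  simp only [ENNReal.toReal_ofNat, Real.rpow_ofNat]
  refine le_trans ?_ (sum_sobolevWeight_sq_le hs u hu hB0 hB (S.image Prod.fst))
  have h1 : ∀ p : (Fin d → ℤ) × Fin m, ‖weightedCoeff s (compL2 i u) p‖ ^ 2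
      = if p.2 = i then (sobolevWeight s p.1 * ‖fourierCoeffReal u p.1‖) ^ 2 else 0 := by
    intro p
    rw [weightedCoeff_compL2]
    split_ifs
    · rw [norm_mul, Complex.norm_real, Real.norm_of_nonneg (sobolevWeight_pos s _).le]
    · simp
  simp only [h1]
  rw [← Finset.sum_filter]
  rw [← Finset.sum_image (s := S.filter fun p => p.2 = i) (g := Prod.fst)
    (f := fun ξ => (sobolevWeight s ξ * ‖fourierCoeffReal u ξ‖) ^ 2)]
  · refine Finset.sum_le_sum_of_subset_of_nonneg
      (Finset.image_subset_image (Finset.filter_subset _ _)) fun _ _ _ => sq_nonneg _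
  · intro p hp q hq hpq
    have h2 := (Finset.mem_filter.1 hp).2
    have h3 := (Finset.mem_filter.1 hq).2
    exact Prod.ext hpq (h2.trans h3.symm)

theorem memℓp_weightedCoeff_compL2 {d m k : ℕ} {s : ℝ} (hs : s ≤ k) (i : Fin m)
    {u : C(Torus d, ℝ)} (hu : u ∈ ckTorus d k) : Memℓp (weightedCoeff s (compL2 i u)) 2 := by
  obtain ⟨hu, B, hB⟩ := hu
  exact memℓp_gen' (sum_weightedCoeff_compL2_le hs i u hu
    (fun x => (u.norm_coe_le_norm x).trans (le_max_left _ B))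
    (fun i x t => (hB i x t).trans (le_max_right _ _)))

/-- The function `u` placed in the `i`-th component, as an element of `H^s(𝕋^d; ℝ^m)`. -/
def compHs {d k : ℕ} {s : ℝ} (hs : s ≤ k) {m : ℕ} (i : Fin m) : ckTorus d k →ₗ[ℝ] Hs s d m where
  toFun u := ⟨compL2 i u.1, memℓp_weightedCoeff_compL2 hs i u.2⟩
  map_add' u v := Subtype.ext (map_add (compL2 i) u.1 v.1)
  map_smul' c u := Subtype.ext (map_smul (compL2 i) c u.1)

theorem norm_compHs_le {d k m : ℕ} {s : ℝ} (hs : s ≤ k) (i : Fin m) (u : ckTorus d k) {B : ℝ}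
    (hB0 : ∀ x, |u.1 x| ≤ B) (hB : ∀ i x t, |iteratedDeriv k (torusLine u.1 i x) t| ≤ B) :
    ‖compHs hs i u‖ ≤ (d + 1) ^ (k + 1) * B := by
  have hB' : 0 ≤ B := (abs_nonneg _).trans (hB0 0)
  change ‖Hs.toLittleL2 (compHs hs i u)‖ ≤ _
  exact lp.norm_le_of_forall_sum_le (by norm_num) (by positivity)
    (sum_weightedCoeff_compL2_le hs i u.1 u.2.1 hB0 hB)

/-! ### Plane waves -/

/-- The real plane wave `x ↦ Re(c e^{2πi ξ·x})`. -/
def wave {d : ℕ} (ξ : Fin d → ℤ) (c : ℂ) : C(Torus d, ℝ) :=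
  ⟨fun x => (c * UnitAddTorus.mFourier ξ x).re,
    Complex.continuous_re.comp (continuous_const.mul (UnitAddTorus.mFourier ξ).continuous)⟩

theorem wave_apply {d : ℕ} (ξ : Fin d → ℤ) (c : ℂ) (x : Torus d) :
    wave ξ c x = (c * UnitAddTorus.mFourier ξ x).re := rfl

/-- `u` depends only on the phase of the plane wave `c e^{2πi ξ·x}`, through the function `F`. -/
def HasPhase {d : ℕ} (ξ : Fin d → ℤ) (c : ℂ) (u : C(Torus d, ℝ)) (F : ℝ → ℝ) : Prop :=
  ∀ x θ, c * UnitAddTorus.mFourier ξ x = ‖c‖ * Complex.exp ((θ : ℝ) * Complex.I) → u x = F θ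

/-- Along a coordinate line the phase of a plane wave is an affine function. -/
theorem HasPhase.exists_line {d : ℕ} {ξ : Fin d → ℤ} {c : ℂ} {u : C(Torus d, ℝ)} {F : ℝ → ℝ}
    (h : HasPhase ξ c u F) (x : Torus d) :
    ∃ θ, u x = F θ ∧ ∀ i, torusLine u i x = fun s => F (2 * Real.pi * ξ i * s + θ) := by
  let z := c * UnitAddTorus.mFourier ξ x
  have hz : z = ‖c‖ * Complex.exp ((z.arg : ℝ) * Complex.I) := by
    have h1 : ‖z‖ = ‖c‖ := by rw [norm_mul, norm_mFourier_apply, mul_one]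
    rw [← h1, Complex.norm_mul_exp_arg_mul_I]
  refine ⟨z.arg, h x _ hz, fun i => funext fun s => h _ _ ?_⟩
  rw [mFourier_apply_add, mFourier_apply_single, ← mul_assoc]
  change z * _ = _
  rw [hz, mul_assoc, ← Complex.exp_add]
  congr 2
  rw [← hz]
  push_cast
  ring

theorem HasPhase.line {d k : ℕ} {ξ : Fin d → ℤ} {c : ℂ} {u : C(Torus d, ℝ)} {F : ℝ → ℝ}
    (h : HasPhase ξ c u F) (hF : ContDiff ℝ k F) {B : ℝ} (hB : ∀ θ, |iteratedDeriv k F θ| ≤ B) :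
    (∀ i x, ContDiff ℝ k (torusLine u i x)) ∧ ∀ i x t, |iteratedDeriv k (torusLine u i x) t|
      ≤ (1 + ∑ i, |2 * Real.pi * ξ i|) ^ k * B := by
  constructor
  · intro i x
    obtain ⟨θ, -, hθ⟩ := h.exists_line x
    rw [hθ i]
    exact hF.comp (by fun_prop)
  · intro i x t
    obtain ⟨θ, -, hθ⟩ := h.exists_line x
    have h1 := iteratedDeriv_comp_const_mul (n := k) (f := fun z => F (z + θ))
      (hF.comp (by fun_prop)) (2 * Real.pi * ξ i)
    rw [iteratedDeriv_comp_add_const] at h1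
    rw [hθ i, h1, abs_mul, abs_pow]
    refine mul_le_mul (pow_le_pow_left₀ (abs_nonneg _) ?_ k) (hB _) (abs_nonneg _) (by positivity)
    have := Finset.single_le_sum (f := fun i => |2 * Real.pi * (ξ i : ℝ)|)
      (fun _ _ => abs_nonneg _) (Finset.mem_univ i)
    linarith

/-- Along every coordinate line the function is `F`, up to an affine change of the variable, so a
single bound for the derivatives of `F` suffices. -/
theorem HasPhase.norm_compHs_le {d k m : ℕ} {s : ℝ} (hs : s ≤ k) (i : Fin m) {ξ : Fin d → ℤ}
    {c : ℂ} {u : ckTorus d k} {F : ℝ → ℝ} (h : HasPhase ξ c u.1 F) (hF : ContDiff ℝ k F) {B : ℝ}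
    (hB0 : ∀ θ, |F θ| ≤ B) (hB : ∀ θ, |iteratedDeriv k F θ| ≤ B) :
    ‖compHs hs i u‖ ≤ (d + 1) ^ (k + 1) * (1 + ∑ i, |2 * Real.pi * ξ i|) ^ k * B := by
  have hB' : 0 ≤ B := (abs_nonneg _).trans (hB0 0)
  rw [mul_assoc]
  refine TFNO.norm_compHs_le hs i u (fun x => ?_) (h.line hF hB).2
  obtain ⟨θ, hθ, -⟩ := h.exists_line x
  rw [hθ]
  refine (hB0 θ).trans (le_mul_of_one_le_left hB' (one_le_pow₀ ?_))
  have : 0 ≤ ∑ i, |2 * Real.pi * (ξ i : ℝ)| := Finset.sum_nonneg fun _ _ => abs_nonneg _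
  linarith

theorem continuous_iteratedDeriv_param {P : Type*} [NormedAddCommGroup P] [NormedSpace ℝ P]
    {k j : ℕ} (hj : j ≤ k) {G : P → ℝ → ℝ} (hG : ContDiff ℝ k (Function.uncurry G)) :
    Continuous (Function.uncurry fun p => iteratedDeriv j (G p)) := by
  induction j generalizing G k with
  | zero => simpa using hG.continuous
  | succ j ih =>
    obtain ⟨k, rfl⟩ : ∃ k', k = k' + 1 := ⟨k - 1, by omega⟩
    simp only [iteratedDeriv_succ']
    refine ih (k := k) (by omega) ?_
    have h0 : ContDiff ℝ (k + 1) (Function.uncurry fun (q : P × ℝ) u => G q.1 u) :=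
      (by exact_mod_cast hG : ContDiff ℝ (k + 1) (Function.uncurry G)).comp
        (by fun_prop : ContDiff ℝ (k + 1) fun q : (P × ℝ) × ℝ => (q.1.1, q.2))
    have h1 : ContDiff ℝ k fun q : P × ℝ => fderiv ℝ (G q.1) q.2 :=
      ContDiff.fderiv (f := fun (q : P × ℝ) u => G q.1 u) h0 contDiff_snd le_rfl
    exact h1.clm_apply (contDiff_const (c := (1 : ℝ)))

theorem eventually_abs_sub_lt_of_periodic {P : Type*} [TopologicalSpace P] {H : P → ℝ → ℝ}
    (hH : Continuous (Function.uncurry H)) {c : ℝ} (hc : 0 < c)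
    (hper : ∀ p, Function.Periodic (H p) c) (p₀ : P) {ε : ℝ} (hε : 0 < ε) :
    ∀ᶠ p in 𝓝 p₀, ∀ θ, |H p θ - H p₀ θ| < ε := by
  let Γ : C(P × Icc (0 : ℝ) c, ℝ) := ⟨fun q => H q.1 q.2,
    hH.comp (continuous_fst.prodMk (continuous_subtype_val.comp continuous_snd))⟩
  filter_upwards [Metric.tendsto_nhds.1 (Γ.curry.continuous.tendsto p₀) ε hε] with p hp θ
  have h1 : ∀ q, H q (toIcoMod hc 0 θ) = H q θ := fun q => by
    rw [toIcoMod, (hper q).sub_zsmul_eq]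
  have h2 := toIcoMod_mem_Ico hc 0 θ
  have h3 := (ContinuousMap.dist_lt_iff hε).1 hp ⟨toIcoMod hc 0 θ, h2.1, by linarith [h2.2]⟩
  rw [← h1, ← h1]
  exact h3

theorem abs_iteratedDeriv_comp_cos_le {k j : ℕ} (hj : j ≤ k) {f : ℝ → ℝ} (hf : ContDiff ℝ k f)
    {y ρ R N : ℝ} (hR : |y| + |ρ| ≤ R)
    (hN : ∀ j ≤ k, ∀ z ∈ Icc (-R) R, |iteratedDeriv j f z| ≤ N) (θ : ℝ) :
    |iteratedDeriv j (fun θ => f (y + ρ * Real.cos θ)) θ| ≤ k.factorial * (1 + R) ^ k * N := by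
  have hR0 : 0 ≤ R := (by positivity : 0 ≤ |y| + |ρ|).trans hR
  have hz : ∀ θ, y + ρ * Real.cos θ ∈ Icc (-R) R := by
    intro θ
    refine abs_le.1 ?_
    refine (abs_add_le _ _).trans (le_trans ?_ hR)
    rw [abs_mul]
    gcongr
    exact mul_le_of_le_one_right (abs_nonneg _) (Real.abs_cos_le_one θ)
  have hN0 : 0 ≤ N := (abs_nonneg _).trans (hN 0 (Nat.zero_le _) _ (hz 0))
  have h1 := norm_iteratedFDeriv_comp_le (n := j) (N := j) (hf.of_le (by exact_mod_cast hj))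
    (f := fun θ => y + ρ * Real.cos θ) (by fun_prop) le_rfl θ (C := N) (D := 1 + R)
    (fun i hi => by
      rw [norm_iteratedFDeriv_eq_norm_iteratedDeriv]
      exact hN i (hi.trans hj) _ (hz θ))
    (fun i hi _ => by
      rw [norm_iteratedFDeriv_eq_norm_iteratedDeriv, iteratedDeriv_const_add (by omega),
        iteratedDeriv_const_mul_field, norm_mul]
      calc ‖ρ‖ * ‖iteratedDeriv i Real.cos θ‖ ≤ R * 1 :=
            mul_le_mul (by rw [Real.norm_eq_abs]; linarith [abs_nonneg y])
              (Real.abs_iteratedDeriv_cos_le_one i θ) (norm_nonneg _) hR0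
        _ ≤ 1 + R := by linarith
        _ ≤ (1 + R) ^ i := le_self_pow₀ (by linarith) (by omega))
  rw [norm_iteratedFDeriv_eq_norm_iteratedDeriv] at h1
  refine h1.trans ?_
  rw [mul_right_comm]
  refine mul_le_mul_of_nonneg_right ?_ hN0
  exact mul_le_mul (by exact_mod_cast Nat.factorial_le hj)
    (pow_le_pow_right₀ (by linarith) hj) (by positivity) (by positivity)

/-- The function `x ↦ f(y + r g(x))`, where `g` is a plane wave and `p = (y, r)`. -/
def waveComp {d : ℕ} {f : ℝ → ℝ} (hf : Continuous f) (ξ : Fin d → ℤ) (c : ℂ) (p : ℝ × ℝ) :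
    C(Torus d, ℝ) :=
  ⟨fun x => f (p.1 + p.2 * wave ξ c x),
    hf.comp (continuous_const.add (continuous_const.mul (wave ξ c).continuous))⟩

theorem hasPhase_waveComp {d : ℕ} {f : ℝ → ℝ} (hf : Continuous f) (ξ : Fin d → ℤ) (c : ℂ)
    (p : ℝ × ℝ) :
    HasPhase ξ c (waveComp hf ξ c p) fun θ => f (p.1 + p.2 * ‖c‖ * Real.cos θ) := by
  intro x θ h
  simp only [waveComp, ContinuousMap.coe_mk, wave_apply, h, Complex.re_ofReal_mul,
    Complex.exp_ofReal_mul_I_re, mul_assoc]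

theorem exists_bound_iteratedDeriv {k : ℕ} {f : ℝ → ℝ} (hf : ContDiff ℝ k f) (R : ℝ) :
    ∃ N, ∀ j ≤ k, ∀ z ∈ Icc (-R) R, |iteratedDeriv j f z| ≤ N := by
  have h1 : ∀ j, ∃ N, j ≤ k → ∀ z ∈ Icc (-R) R, |iteratedDeriv j f z| ≤ N := by
    intro j
    by_cases hj : j ≤ k
    · obtain ⟨N, hN⟩ := (isCompact_Icc (a := -R) (b := R)).exists_bound_of_continuousOn
        (hf.continuous_iteratedDeriv j (by exact_mod_cast hj)).continuousOn
      exact ⟨N, fun _ => hN⟩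
    · exact ⟨0, fun h => absurd h hj⟩
  choose N hN using h1
  refine ⟨∑ j ∈ Finset.range (k + 1), |N j|, fun j hj z hz => ?_⟩
  refine ((hN j hj z hz).trans (le_abs_self _)).trans ?_
  exact Finset.single_le_sum (f := fun j => |N j|) (fun _ _ => abs_nonneg _)
    (Finset.mem_range.2 (Nat.lt_succ_of_le hj))

theorem waveComp_mem {d k : ℕ} {f : ℝ → ℝ} (hf : ContDiff ℝ k f) (ξ : Fin d → ℤ) (c : ℂ)
    (p : ℝ × ℝ) : waveComp hf.continuous ξ c p ∈ ckTorus d k := by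
  obtain ⟨N, hN⟩ := exists_bound_iteratedDeriv hf (|p.1| + |p.2 * ‖c‖|)
  have h := (hasPhase_waveComp hf.continuous ξ c p).line (k := k) (hf.comp (by fun_prop))
    (abs_iteratedDeriv_comp_cos_le le_rfl hf le_rfl hN)
  exact ⟨h.1, _, h.2⟩

/-- The function `x ↦ f(y + r g(x))`, where `g` is a plane wave and `p = (y, r)`, placed in the
`i`-th component, as an element of `H^s(𝕋^d; ℝ^m)`. -/
def waveHs {d k m : ℕ} {s : ℝ} (hs : s ≤ k) {f : ℝ → ℝ} (hf : ContDiff ℝ k f) (ξ : Fin d → ℤ)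
    (c : ℂ) (i : Fin m) (p : ℝ × ℝ) : Hs s d m :=
  compHs hs i ⟨waveComp hf.continuous ξ c p, waveComp_mem hf ξ c p⟩

theorem coeFn_waveHs {d k m : ℕ} {s : ℝ} (hs : s ≤ k) {f : ℝ → ℝ} (hf : ContDiff ℝ k f)
    (ξ : Fin d → ℤ) (c : ℂ) (i : Fin m) (p : ℝ × ℝ) :
    (waveHs hs hf ξ c i p).toL2 =ᵐ[torusMeasure d]
      fun x => f (p.1 + p.2 * wave ξ c x) • EuclideanSpace.single i (1 : ℝ) :=
  coeFn_compL2 i _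

theorem norm_waveHs_le {d k m : ℕ} {s : ℝ} (hs : s ≤ k) {f : ℝ → ℝ} (hf : ContDiff ℝ k f)
    (ξ : Fin d → ℤ) (c : ℂ) (i : Fin m) (p : ℝ × ℝ) {R N : ℝ} (hR : |p.1| + |p.2 * ‖c‖| ≤ R)
    (hN : ∀ j ≤ k, ∀ z ∈ Icc (-R) R, |iteratedDeriv j f z| ≤ N) :
    ‖waveHs hs hf ξ c i p‖ ≤ (d + 1) ^ (k + 1) * (1 + ∑ i, |2 * Real.pi * ξ i|) ^ k *
      (k.factorial * (1 + R) ^ k * N) := by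
  refine (hasPhase_waveComp hf.continuous ξ c p).norm_compHs_le hs i
    (u := ⟨_, waveComp_mem hf ξ c p⟩) (hf.comp (by fun_prop)) (fun θ => ?_)
    (abs_iteratedDeriv_comp_cos_le le_rfl hf hR hN)
  simpa using abs_iteratedDeriv_comp_cos_le (Nat.zero_le k) hf hR hN θ

/-- The dependence of the `H^s` norm on the parameters is controlled by derivatives in the phase,
which are jointly continuous, and uniformly so by periodicity. -/
theorem continuous_waveHs {d k m : ℕ} {s : ℝ} (hs : s ≤ k) {f : ℝ → ℝ} (hf : ContDiff ℝ k f)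
    (ξ : Fin d → ℤ) (c : ℂ) (i : Fin m) : Continuous (waveHs hs hf ξ c i) := by
  let F : ℝ × ℝ → ℝ → ℝ := fun p θ => f (p.1 + p.2 * ‖c‖ * Real.cos θ)
  have hF : ContDiff ℝ k (Function.uncurry F) := hf.comp (by fun_prop)
  have hFp : ∀ p, ContDiff ℝ k (F p) := fun p => hf.comp (by fun_prop)
  have hper : ∀ j p, Function.Periodic (iteratedDeriv j (F p)) (2 * Real.pi) := by
    intro j p θ
    have h1 := congrFun (iteratedDeriv_comp_add_const (n := j) (f := F p) (s := 2 * Real.pi)) θ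
    rw [← h1]
    congr 1
    funext θ
    simp only [F, Real.cos_add_two_pi]
  rw [continuous_iff_continuousAt]
  intro p₀
  rw [ContinuousAt, Metric.tendsto_nhds]
  intro ε hε
  set C : ℝ := (d + 1) ^ (k + 1) * (1 + ∑ i, |2 * Real.pi * ξ i|) ^ k with hC
  have hCpos : 0 < C := by positivity
  have hδ : 0 < ε / (2 * C) := by positivity
  have key := fun j (hj : j ≤ k) => eventually_abs_sub_lt_of_periodic
    (continuous_iteratedDeriv_param hj hF) Real.two_pi_pos (hper j) p₀ hδ
  filter_upwards [key 0 (Nat.zero_le k), key k le_rfl] with p h0 hk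
  rw [dist_eq_norm, waveHs, waveHs, ← map_sub]
  have hphase : HasPhase ξ c (waveComp hf.continuous ξ c p - waveComp hf.continuous ξ c p₀)
      (F p - F p₀) := fun x θ h => by
    rw [ContinuousMap.sub_apply, hasPhase_waveComp hf.continuous ξ c p x θ h,
      hasPhase_waveComp hf.continuous ξ c p₀ x θ h]
    rfl
  have h1 : ‖compHs hs i (⟨_, waveComp_mem hf ξ c p⟩ - ⟨_, waveComp_mem hf ξ c p₀⟩ : ckTorus d k)‖
      ≤ C * (ε / (2 * C)) := by
    refine HasPhase.norm_compHs_le hs i (F := F p - F p₀) hphase ((hFp p).sub (hFp p₀))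
      (fun θ => by simpa using (h0 θ).le) (fun θ => ?_)
    rw [iteratedDeriv_sub (hFp p).contDiffAt (hFp p₀).contDiffAt]
    exact (hk θ).le
  refine h1.trans_lt ?_
  field_simp
  norm_num

/-- Passing from `f` to a linear combination of functions `z ↦ f(w z + b)` amounts to an affine
change of the parameters. -/
theorem waveHs_sub_sum {d k m n : ℕ} {s : ℝ} (hs : s ≤ k) {f g : ℝ → ℝ} (hf : ContDiff ℝ k f)
    (hg : ContDiff ℝ k g) (ξ : Fin d → ℤ) (c : ℂ) (i : Fin m) (p : ℝ × ℝ) (a w b : Fin n → ℝ)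
    (hfg : ContDiff ℝ k fun z => f z - ∑ l, a l * g (w l * z + b l)) :
    waveHs hs hfg ξ c i p = waveHs hs hf ξ c i p
      - ∑ l, a l • waveHs hs hg ξ c i (w l * p.1 + b l, w l * p.2) := by
  simp only [waveHs, ← map_smul, ← map_sum, ← map_sub]
  refine congrArg _ (Subtype.ext (ContinuousMap.ext fun x => ?_))
  simp only [waveComp, ContinuousMap.coe_mk, Submodule.coe_sub, Submodule.coe_sum,
    Submodule.coe_smul, ContinuousMap.sub_apply, ContinuousMap.sum_apply, ContinuousMap.smul_apply,
    smul_eq_mul]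
  congr 1
  refine Finset.sum_congr rfl fun l _ => ?_
  ring_nf

/-- Difference of squares: `(y + r g)² - (y - r g)² = 4 y r g`. -/
theorem waveHs_sq_sub {d k m : ℕ} {s : ℝ} (hs : s ≤ k) (ξ : Fin d → ℤ) (c : ℂ) (i : Fin m)
    (h2 : ContDiff ℝ k fun z : ℝ => z ^ 2) (y r : ℝ) :
    waveHs hs h2 ξ c i (y, r) - waveHs hs h2 ξ c i (y, -r)
      = (4 * (y * r)) • waveHs hs (contDiff_id (𝕜 := ℝ) (E := ℝ)) ξ c i (0, 1) := by
  simp only [waveHs, ← map_smul, ← map_sub]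
  refine congrArg _ (Subtype.ext (ContinuousMap.ext fun x => ?_))
  simp only [waveComp, ContinuousMap.coe_mk, Submodule.coe_sub, Submodule.coe_smul,
    ContinuousMap.sub_apply, ContinuousMap.smul_apply, smul_eq_mul, id]
  ring

/-! ### Density of trigonometric polynomials -/

theorem fourierCoeffReal_wave {d : ℕ} (ξ η : Fin d → ℤ) (c : ℂ) :
    fourierCoeffReal (wave ξ c) η
      = ((if ξ = η then c else 0) + if ξ = -η then starRingEnd ℂ c else 0) / 2 := by
  have h1 : ∀ x, UnitAddTorus.mFourier (-η) x * ((wave ξ c x : ℝ) : ℂ)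
      = c / 2 * UnitAddTorus.mFourier (-η + ξ) x
        + starRingEnd ℂ c / 2 * UnitAddTorus.mFourier (-η + -ξ) x := by
    intro x
    rw [wave_apply, Complex.re_eq_add_conj, map_mul, ← UnitAddTorus.mFourier_neg,
      UnitAddTorus.mFourier_add, UnitAddTorus.mFourier_add]
    ring
  rw [fourierCoeffReal_eq]
  simp only [h1]
  rw [integral_add (continuous_integrable_torus (by fun_prop))
    (continuous_integrable_torus (by fun_prop)), integral_const_mul, integral_const_mul,
    integral_mFourier, integral_mFourier]
  have h2 : -η + ξ = 0 ↔ ξ = η := by rw [neg_add_eq_zero, eq_comm]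
  have h3 : -η + -ξ = 0 ↔ ξ = -η := by rw [← sub_eq_add_neg, sub_eq_zero, eq_comm]
  simp only [h2, h3, mul_ite, mul_one, mul_zero]
  split_ifs <;> ring

theorem toLittleL2_waveHs_apply {d k m : ℕ} {s : ℝ} (hs : s ≤ k) (ξ : Fin d → ℤ) (c : ℂ)
    (i : Fin m) (p : (Fin d → ℤ) × Fin m) :
    Hs.toLittleL2 (waveHs hs (contDiff_id (𝕜 := ℝ) (E := ℝ)) ξ c i (0, 1)) p
      = if p.2 = i then sobolevWeight s p.1 *
        (((if ξ = p.1 then c else 0) + if ξ = -p.1 then starRingEnd ℂ c else 0) / 2) else 0 := by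
  change weightedCoeff s (compL2 i (waveComp continuous_id ξ c (0, 1))) p = _
  have h : waveComp continuous_id ξ c (0, 1) = wave ξ c := by
    ext x
    simp [waveComp]
  rw [weightedCoeff_compL2, h, fourierCoeffReal_wave]

/-- Trigonometric polynomials are dense in `H^s`. -/
theorem mem_closure_span_waveHs {d k m : ℕ} {s : ℝ} (hs : s ≤ k) (u : Hs s d m) :
    u ∈ closure (Submodule.span ℝ (range fun q : (Fin d → ℤ) × ℂ × Fin m =>
      waveHs hs (contDiff_id (𝕜 := ℝ) (E := ℝ)) q.1 q.2.1 q.2.2 (0, 1)) : Set (Hs s d m)) := by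
  rw [Metric.mem_closure_iff]
  intro ε hε
  set f := Hs.toLittleL2 u with hf
  have hsum := lp.hasSum_single (p := 2) (by norm_num) f
  obtain ⟨T₀, hT₀⟩ := Filter.eventually_atTop.1 (Metric.tendsto_nhds.1 hsum ε hε)
  -- a set of wavenumbers that is symmetric, so that the truncated Fourier series is real
  let S : Finset (Fin d → ℤ) := T₀.image Prod.fst ∪ T₀.image fun p => -p.1
  have hSneg : ∀ η, -η ∈ S ↔ η ∈ S := by
    intro η
    simp only [S, Finset.mem_union, Finset.mem_image]
    constructor <;> rintro (⟨p, hp, h⟩ | ⟨p, hp, h⟩)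
    · exact Or.inr ⟨p, hp, by rw [h, neg_neg]⟩
    · exact Or.inl ⟨p, hp, neg_injective h⟩
    · exact Or.inr ⟨p, hp, by rw [h]⟩
    · exact Or.inl ⟨p, hp, by rw [← h, neg_neg]⟩
  have hT := hT₀ (S ×ˢ Finset.univ) fun p hp => Finset.mem_product.2
    ⟨Finset.mem_union_left _ (Finset.mem_image_of_mem _ hp), Finset.mem_univ _⟩
  let a : (Fin d → ℤ) → Fin m → ℂ := fun ξ j => fourierCoeffReal (fun x => u.toL2 x j) ξ
  refine ⟨∑ ξ ∈ S, ∑ j, waveHs hs (contDiff_id (𝕜 := ℝ) (E := ℝ)) ξ (a ξ j) j (0, 1),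
    Submodule.sum_mem _ fun ξ _ => Submodule.sum_mem _ fun j _ =>
      Submodule.subset_span ⟨(ξ, a ξ j, j), rfl⟩, ?_⟩
  rw [dist_comm, dist_eq_norm]
  change ‖Hs.toLittleL2 (_ - u)‖ < ε
  rw [map_sub, ← dist_eq_norm]
  convert! hT using 2
  simp only [map_sum]
  ext ⟨η, j⟩
  simp only [lp.coeFn_sum, Finset.sum_apply, toLittleL2_waveHs_apply, Finset.sum_ite_eq,
    Finset.mem_univ, if_true]
  rw [← Finset.mul_sum, ← Finset.sum_div, Finset.sum_add_distrib, Finset.sum_ite_eq',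
    Finset.sum_ite_eq']
  have ha : starRingEnd ℂ (a (-η) j) = a η j := by
    simp only [a]
    rw [Layer.fourierCoeffReal_neg, Complex.conj_conj]
  have hfa : f (η, j) = sobolevWeight s η * a η j := rfl
  simp only [hSneg, ha, lp.single_apply]
  refine Eq.trans ?_ (Finset.sum_pi_single (M := fun _ : (Fin d → ℤ) × Fin m => ℂ) (η, j) f
    (S ×ˢ Finset.univ)).symm
  simp only [Finset.mem_product, Finset.mem_univ, and_true, hfa]
  split_ifs <;> simp

/-! ### Averaged neurons are dense in `C(K)` -/

theorem exists_ridge_approx_of_continuous {σ f : ℝ → ℝ} (hσ : Continuous σ)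
    (hpoly : ¬ ∃ p : ℝ[X], ∀ x, σ x = p.eval x) (hf : Continuous f) (R : ℝ) {ε : ℝ} (hε : 0 < ε) :
    ∃ (m : ℕ) (c w b : Fin m → ℝ), ∀ x ∈ Icc (-R) R,
      |f x - ∑ i, c i * σ (w i * x + b i)| < ε := by
  obtain ⟨p, hp⟩ := exists_polynomial_near_of_continuousOn (-R) R f hf.continuousOn (ε / 2)
    (half_pos hε)
  obtain ⟨m, c, w, b, h⟩ := exists_ridge_approx (k := 0) (contDiff_zero.2 hσ) hpoly p R
    (half_pos hε)
  refine ⟨m, c, w, b, fun x hx => ?_⟩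
  have h1 := hp x hx
  have h2 := h 0 le_rfl x hx
  rw [iteratedDeriv_zero] at h2
  rw [abs_lt] at *
  constructor <;> linarith [h1.1, h1.2, h2.1, h2.2]

/-- A form of the Stone-Weierstrass theorem: a multiplicative family of functions that separates
points spans a dense subspace. -/
theorem mem_closure_span_of_separatesPoints {X : Type*} [TopologicalSpace X] [CompactSpace X]
    (S : Submonoid C(X, ℝ)) (hS : ∀ x y, x ≠ y → ∃ f ∈ S, f x ≠ f y) (φ : C(X, ℝ)) :
    φ ∈ closure (Submodule.span ℝ (S : Set C(X, ℝ)) : Set C(X, ℝ)) := by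
  have h := ContinuousMap.subalgebra_topologicalClosure_eq_top_of_separatesPoints
    (Algebra.adjoin ℝ (S : Set C(X, ℝ))) (fun x y hxy => by
      obtain ⟨f, hf, hfxy⟩ := hS x y hxy
      exact ⟨f, ⟨f, Algebra.subset_adjoin hf, rfl⟩, hfxy⟩)
  have h1 : φ ∈ (Algebra.adjoin ℝ (S : Set C(X, ℝ))).topologicalClosure := by
    rw [h]; exact Algebra.mem_top
  have h2 : ((Algebra.adjoin ℝ (S : Set C(X, ℝ)) : Subalgebra ℝ C(X, ℝ)) : Set C(X, ℝ))
      = (Submodule.span ℝ (S : Set C(X, ℝ)) : Set C(X, ℝ)) := by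
    rw [← Subalgebra.coe_toSubmodule, Algebra.adjoin_eq_span, Submonoid.closure_eq]
  rw [← h2]
  exact h1

theorem abs_integral_torus_le {d : ℕ} {f : Torus d → ℝ} {B : ℝ} (hB : ∀ x, |f x| ≤ B) :
    |∫ x, f x ∂torusMeasure d| ≤ B := by
  have := norm_integral_le_of_norm_le_const (μ := torusMeasure d) (f := f) (C := B)
    (Eventually.of_forall hB)
  simpa using this

/-- The average over the torus of a function that depends continuously on a parameter. -/
def torusMean {X : Type*} [TopologicalSpace X] {d : ℕ} (g : C(X × Torus d, ℝ)) : C(X, ℝ) where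
  toFun a := ∫ x, g (a, x) ∂torusMeasure d
  continuous_toFun := by
    have h : LipschitzWith 1 fun u : C(Torus d, ℝ) => ∫ x, u x ∂torusMeasure d := by
      refine LipschitzWith.of_dist_le_mul fun u v => ?_
      rw [NNReal.coe_one, one_mul, Real.dist_eq, ← integral_sub
        (continuous_integrable_torus u.continuous) (continuous_integrable_torus v.continuous)]
      exact abs_integral_torus_le fun x => ContinuousMap.dist_apply_le_dist (f := u) (g := v) x
    exact h.continuous.comp g.curry.continuous

/-- The Fourier coefficient of the `c`-th component of an element of the Sobolev space. -/
def Hs.coeff {s : ℝ} {d m : ℕ} (u : Hs s d m) (ξ : Fin d → ℤ) (c : Fin m) : ℂ :=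
  fourierCoeffReal (fun x => u.toL2 x c) ξ

theorem Hs.toLittleL2_apply {s : ℝ} {d m : ℕ} (u : Hs s d m) (ξ : Fin d → ℤ) (c : Fin m) :
    Hs.toLittleL2 u (ξ, c) = sobolevWeight s ξ * u.coeff ξ c := rfl

theorem Hs.coeff_neg {s : ℝ} {d m : ℕ} (u : Hs s d m) (ξ : Fin d → ℤ) (c : Fin m) :
    u.coeff (-ξ) c = starRingEnd ℂ (u.coeff ξ c) := Layer.fourierCoeffReal_neg _ _

theorem Hs.continuous_coeff {s : ℝ} {d m : ℕ} (ξ : Fin d → ℤ) (c : Fin m) :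
    Continuous fun u : Hs s d m => u.coeff ξ c := by
  have hw : (sobolevWeight s ξ : ℂ) ≠ 0 := by
    exact_mod_cast (sobolevWeight_pos s ξ).ne'
  have h1 : LipschitzWith 1 fun u : Hs s d m => Hs.toLittleL2 u (ξ, c) := by
    refine LipschitzWith.of_dist_le_mul fun u v => ?_
    rw [NNReal.coe_one, one_mul, dist_eq_norm, dist_eq_norm]
    have h2 := lp.norm_apply_le_norm (p := 2) (by norm_num) (Hs.toLittleL2 (u - v)) (ξ, c)
    have h3 : Hs.toLittleL2 (u - v) (ξ, c)
        = Hs.toLittleL2 u (ξ, c) - Hs.toLittleL2 v (ξ, c) := by rw [map_sub]; rfl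
    rw [h3] at h2
    exact h2
  have h3 : (fun u : Hs s d m => u.coeff ξ c)
      = fun u => (sobolevWeight s ξ : ℂ)⁻¹ * Hs.toLittleL2 u (ξ, c) := by
    funext u
    rw [Hs.toLittleL2_apply, inv_mul_cancel_left₀ hw]
  rw [h3]
  exact continuous_const.mul h1.continuous

theorem Hs.exists_coeff_ne {s : ℝ} {d m : ℕ} {u v : Hs s d m} (h : u ≠ v) :
    ∃ ξ c, u.coeff ξ c ≠ v.coeff ξ c := by
  by_contra! hcon
  refine h (Hs.toLittleL2_injective ?_)
  ext ⟨ξ, c⟩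
  rw [Hs.toLittleL2_apply, Hs.toLittleL2_apply, hcon]

/-- The real convolution filters with finitely many active modes, which map vector-valued functions
to scalar functions, given by their Fourier multipliers. -/
def filterSubmodule (d m : ℕ) : Submodule ℝ ((Fin d → ℤ) →₀ (Fin m → ℂ)) where
  carrier := {r | ∀ ξ c, r (-ξ) c = starRingEnd ℂ (r ξ c)}
  zero_mem' := by simp
  add_mem' {r r'} hr hr' ξ c := by
    simp only [Finsupp.add_apply, Pi.add_apply, map_add, hr ξ c, hr' ξ c]
  smul_mem' w r hr ξ c := by
    simp only [Finsupp.smul_apply, Pi.smul_apply, hr ξ c, Complex.real_smul, map_mul,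
      Complex.conj_ofReal]

/-- The output of a filter at the point `x`. The real part is taken mode by mode; for a filter in
`filterSubmodule` the sum over all modes is real anyway. -/
def filterOut {s : ℝ} {d m : ℕ} (r : (Fin d → ℤ) →₀ (Fin m → ℂ)) (a : Hs s d m)
    (x : Torus d) : ℝ :=
  r.sum fun ξ ρ => (UnitAddTorus.mFourier ξ x * ∑ c, ρ c * a.coeff ξ c).re

theorem filterOut_add {s : ℝ} {d m : ℕ} (r r' : (Fin d → ℤ) →₀ (Fin m → ℂ)) (a : Hs s d m)
    (x : Torus d) : filterOut (r + r') a x = filterOut r a x + filterOut r' a x := by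
  refine Finsupp.sum_add_index' (fun ξ => by simp) fun ξ ρ ρ' => ?_
  simp only [Pi.add_apply, add_mul, Finset.sum_add_distrib, mul_add, Complex.add_re]

theorem filterOut_smul {s : ℝ} {d m : ℕ} (w : ℝ) (r : (Fin d → ℤ) →₀ (Fin m → ℂ)) (a : Hs s d m)
    (x : Torus d) : filterOut (w • r) a x = w * filterOut r a x := by
  refine (Finsupp.sum_smul_index' fun ξ => by simp).trans ?_
  rw [filterOut, Finsupp.mul_sum]
  refine Finsupp.sum_congr fun ξ _ => ?_
  simp only [Pi.smul_apply, Complex.real_smul, mul_assoc, ← Finset.mul_sum]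
  rw [mul_left_comm, Complex.re_ofReal_mul]

theorem filterOut_zero {s : ℝ} {d m : ℕ} (a : Hs s d m) (x : Torus d) :
    filterOut 0 a x = 0 := Finsupp.sum_zero_index

theorem continuous_filterOut {s : ℝ} {d m : ℕ} (r : (Fin d → ℤ) →₀ (Fin m → ℂ)) :
    Continuous fun p : Hs s d m × Torus d => filterOut r p.1 p.2 := by
  refine continuous_finsetSum _ fun ξ _ => Complex.continuous_re.comp ?_
  refine ((UnitAddTorus.mFourier ξ).continuous.comp continuous_snd).mul ?_
  exact continuous_finsetSum _ fun c _ =>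
    continuous_const.mul ((Hs.continuous_coeff ξ c).comp continuous_fst)

theorem continuous_filterOut_apply {s : ℝ} {d m : ℕ} (r : (Fin d → ℤ) →₀ (Fin m → ℂ))
    (a : Hs s d m) : Continuous fun x => filterOut r a x :=
  continuous_finsetSum _ fun ξ _ => Complex.continuous_re.comp
    ((UnitAddTorus.mFourier ξ).continuous.mul continuous_const)

/-- The values at `0` of real convolutions separate the points of `H^s`. -/
theorem exists_filterOut_zero_ne {s : ℝ} {d m : ℕ} {a a' : Hs s d m} (h : a ≠ a') :
    ∃ r ∈ filterSubmodule d m, filterOut r a 0 ≠ filterOut r a' 0 := by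
  obtain ⟨ξ, c, hne⟩ := Hs.exists_coeff_ne h
  let r : ℂ → (Fin d → ℤ) →₀ (Fin m → ℂ) := fun z =>
    Finsupp.single ξ (Pi.single c z) + Finsupp.single (-ξ) (Pi.single c (starRingEnd ℂ z))
  have hr : ∀ z, r z ∈ filterSubmodule d m := by
    intro z η j
    have h1 : ξ = -η ↔ -ξ = η := by rw [neg_eq_iff_eq_neg]
    by_cases hj : j = c
    · subst hj
      simp only [r, Finsupp.add_apply, Finsupp.single_apply, h1, neg_inj, Pi.add_apply]
      split_ifs <;> simp [add_comm]
    · simp only [r, Finsupp.add_apply, Finsupp.single_apply, Pi.add_apply]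
      split_ifs <;> simp [hj]
  have hout : ∀ z (b : Hs s d m), filterOut (r z) b 0 = 2 * (z * b.coeff ξ c).re := by
    intro z b
    have h1 : ∀ η y, filterOut (Finsupp.single η (Pi.single c y)) b 0 = (y * b.coeff η c).re := by
      intro η y
      refine (Finsupp.sum_single_index (by simp)).trans ?_
      rw [mFourier_apply_zero, one_mul, Finset.sum_eq_single c (fun j _ hj => by simp [hj])
        (by simp), Pi.single_eq_same]
    rw [filterOut_add, h1, h1, Hs.coeff_neg, ← map_mul, Complex.conj_re, two_mul]
  by_cases hre : (a.coeff ξ c).re = (a'.coeff ξ c).re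
  · refine ⟨r Complex.I, hr _, ?_⟩
    rw [hout, hout]
    have him : (a.coeff ξ c).im ≠ (a'.coeff ξ c).im := fun h2 => hne (Complex.ext hre h2)
    simpa using him
  · refine ⟨r 1, hr _, ?_⟩
    rw [hout, hout]
    simpa using hre

/-- The parameters of a scalar neuron `σ(r ∗ a + b)` of a first layer: a real convolution filter
with finitely many modes and a smooth bias. -/
structure Neuron (d m : ℕ) where
  r : (Fin d → ℤ) →₀ (Fin m → ℂ)
  r_mem : r ∈ filterSubmodule d m
  b : C(Torus d, ℝ)
  b_smooth : ContDiff ℝ ∞ fun y : Fin d → ℝ => b fun i => (y i : UnitAddCircle)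

/-- The output of a neuron, as a function of the input and of the point of the torus. -/
def Neuron.out {d m : ℕ} (s : ℝ) {f : ℝ → ℝ} (hf : Continuous f) (θ : Neuron d m) :
    C(Hs s d m × Torus d, ℝ) :=
  ⟨fun p => f (filterOut θ.r p.1 p.2 + θ.b p.2),
    hf.comp ((continuous_filterOut θ.r).add (θ.b.continuous.comp continuous_snd))⟩

/-- The average of the output of a neuron over the torus, as a functional of the input. -/
def Neuron.mean {d m : ℕ} (s : ℝ) {f : ℝ → ℝ} (hf : Continuous f) (θ : Neuron d m) :
    C(Hs s d m, ℝ) := torusMean (θ.out s hf)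

/-- The neuron whose preactivation is `w z + c`, where `z` is the preactivation of `θ`. -/
def Neuron.affine {d m : ℕ} (θ : Neuron d m) (w c : ℝ) : Neuron d m where
  r := w • θ.r
  r_mem := Submodule.smul_mem _ w θ.r_mem
  b := w • θ.b + ContinuousMap.const _ c
  b_smooth := (contDiff_const.mul θ.b_smooth).add contDiff_const

/-- The activation function may be replaced by any continuous function, since that function is a
limit of linear combinations of `z ↦ σ(w z + c)`, and the class of neurons is closed under affine
changes of the preactivation. -/
theorem Neuron.mean_mem_closure {d m : ℕ} {s : ℝ} {σ f : ℝ → ℝ} (hσ : Continuous σ)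
    (hpoly : ¬ ∃ p : ℝ[X], ∀ x, σ x = p.eval x) (hf : Continuous f) {X : Type*}
    [TopologicalSpace X] [CompactSpace X] (ι : C(X, Hs s d m)) (θ : Neuron d m) :
    (θ.mean s hf).comp ι ∈
      closure (Submodule.span ℝ (range fun θ : Neuron d m => (θ.mean s hσ).comp ι) :
        Set C(X, ℝ)) := by
  obtain ⟨R, hR⟩ := (isCompact_univ (X := X × Torus d)).exists_bound_of_continuousOn
    (f := fun p => filterOut θ.r (ι p.1) p.2 + θ.b p.2)
    (((continuous_filterOut θ.r).comp ((ι.continuous.comp continuous_fst).prodMk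
      continuous_snd)).add (θ.b.continuous.comp continuous_snd)).continuousOn
  rw [Metric.mem_closure_iff]
  intro ε hε
  obtain ⟨n, c, w, b, h⟩ := exists_ridge_approx_of_continuous hσ hpoly hf R (half_pos hε)
  refine ⟨∑ i, c i • ((θ.affine (w i) (b i)).mean s hσ).comp ι, Submodule.sum_mem _ fun i _ =>
    Submodule.smul_mem _ _ (Submodule.subset_span (mem_range_self _)), ?_⟩
  refine lt_of_le_of_lt ((ContinuousMap.dist_le (half_pos hε).le).2 fun a => ?_) (half_lt_self hε)
  rw [Real.dist_eq, ContinuousMap.sum_apply]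
  simp only [ContinuousMap.smul_apply, ContinuousMap.comp_apply, smul_eq_mul]
  change |(∫ x, θ.out s hf (ι a, x) ∂torusMeasure d)
    - ∑ i, c i * ∫ x, (θ.affine (w i) (b i)).out s hσ (ι a, x) ∂torusMeasure d| ≤ ε / 2
  have hint : ∀ g : C(Hs s d m × Torus d, ℝ),
      Integrable (fun x => g (ι a, x)) (torusMeasure d) := fun g =>
    continuous_integrable_torus (g.continuous.comp (by fun_prop))
  simp only [← integral_const_mul]
  rw [← integral_finsetSum _ fun i _ => (hint _).const_mul _, ← integral_sub (hint _)
    (integrable_finsetSum _ fun i _ => (hint _).const_mul _)]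
  refine abs_integral_torus_le fun x => (le_of_eq ?_).trans
    (h _ (abs_le.1 (hR (a, x) (mem_univ _)))).le
  simp only [Neuron.out, Neuron.affine, ContinuousMap.coe_mk, filterOut_smul,
    ContinuousMap.add_apply, ContinuousMap.smul_apply, ContinuousMap.const_apply, smul_eq_mul]
  congr 2
  refine Finset.sum_congr rfl fun i _ => ?_
  congr 2
  ring

theorem contDiff_wave {d : ℕ} (ξ : Fin d → ℤ) (c : ℂ) :
    ContDiff ℝ ∞ fun y : Fin d → ℝ => wave ξ c fun i => (y i : UnitAddCircle) := by
  simp only [wave_apply, UnitAddTorus.mFourier, ContinuousMap.coe_mk, fourier_coe_apply]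
  refine Complex.reCLM.contDiff.comp (contDiff_const.mul (contDiff_prod fun i _ => ?_))
  refine ContDiff.cexp (ContDiff.div_const (contDiff_const.mul ?_) _)
  exact Complex.ofRealCLM.contDiff.comp (contDiff_apply ℝ ℝ i)

theorem abs_wave_le {d : ℕ} (ξ : Fin d → ℤ) (c : ℂ) (x : Torus d) : |wave ξ c x| ≤ ‖c‖ := by
  rw [wave_apply]
  refine (Complex.abs_re_le_norm _).trans ?_
  rw [norm_mul, norm_mFourier_apply, mul_one]

/-- A continuous function whose Fourier coefficients vanish is zero. -/
theorem eq_zero_of_integral_wave {d : ℕ} (h : C(Torus d, ℝ))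
    (h0 : ∀ ξ c, ‖c‖ ≤ 1 → ∫ x, wave ξ c x * h x ∂torusMeasure d = 0) : h = 0 := by
  let H : C(Torus d, ℂ) := ⟨fun x => (h x : ℂ), Complex.continuous_ofReal.comp h.continuous⟩
  have hcoef : UnitAddTorus.mFourierCoeff H = 0 := by
    funext ξ
    rw [mFourierCoeff_eq]
    have h1 : ∀ x, UnitAddTorus.mFourier (-ξ) x * H x = ((wave (-ξ) 1 x * h x : ℝ) : ℂ)
        + Complex.I * ((wave (-ξ) (-Complex.I) x * h x : ℝ) : ℂ) := by
      intro x
      simp only [wave_apply, one_mul, H, ContinuousMap.coe_mk]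
      rw [neg_mul, Complex.neg_re, Complex.I_mul_re, neg_neg]
      conv_lhs => rw [← Complex.re_add_im (UnitAddTorus.mFourier (-ξ) x)]
      push_cast
      ring
    simp only [h1]
    rw [integral_add (continuous_integrable_torus (by fun_prop))
      (continuous_integrable_torus (by fun_prop)), integral_const_mul,
      integral_complex_ofReal, integral_complex_ofReal, h0 _ _ (by simp), h0 _ _ (by simp)]
    simp
  ext x
  have h2 := UnitAddTorus.hasSum_mFourier_series_apply_of_summable (f := H)
    (by rw [hcoef]; exact summable_zero) x
  simp only [hcoef, Pi.zero_apply, zero_smul] at h2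
  have h3 : H x = 0 := h2.unique hasSum_zero
  simpa [H] using h3

/-- The neuron with filter `r` and bias `0`. -/
def Neuron.ofFilter {d m : ℕ} (r : (Fin d → ℤ) →₀ (Fin m → ℂ)) (hr : r ∈ filterSubmodule d m) :
    Neuron d m := ⟨r, hr, 0, contDiff_const (c := (0 : ℝ))⟩

/-- The bias `log (2 + g)`, for a plane wave `g`, turns the exponential into the weight
`2 + g`. -/
def Neuron.ofFilterWave {d m : ℕ} (r : (Fin d → ℤ) →₀ (Fin m → ℂ)) (hr : r ∈ filterSubmodule d m)
    (ξ : Fin d → ℤ) (c : ℂ) (hc : ‖c‖ ≤ 1) : Neuron d m where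
  r := r
  r_mem := hr
  b := ⟨fun x => Real.log (2 + wave ξ c x), by
    refine Continuous.log (by fun_prop) fun x => ?_
    have := (abs_le.1 (abs_wave_le ξ c x)).1
    exact ne_of_gt (by linarith)⟩
  b_smooth := by
    refine ContDiff.log (contDiff_const.add (contDiff_wave ξ c)) fun y => ?_
    have := (abs_le.1 (abs_wave_le ξ c fun i => (y i : UnitAddCircle))).1
    exact ne_of_gt (by linarith)

/-- The function `(x, a) ↦ exp ((r ∗ a)(x))`. -/
def expFilter {d m : ℕ} {s : ℝ} {X : Type*} [TopologicalSpace X] (ι : C(X, Hs s d m))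
    (r : (Fin d → ℤ) →₀ (Fin m → ℂ)) : C(Torus d × X, ℝ) :=
  ⟨fun p => Real.exp (filterOut r (ι p.2) p.1), ((continuous_filterOut r).comp
    ((ι.continuous.comp continuous_snd).prodMk continuous_fst)).rexp⟩

theorem expFilter_apply {d m : ℕ} {s : ℝ} {X : Type*} [TopologicalSpace X] (ι : C(X, Hs s d m))
    (r : (Fin d → ℤ) →₀ (Fin m → ℂ)) (x : Torus d) (a : X) :
    expFilter ι r (x, a) = Real.exp (filterOut r (ι a) x) := rfl

theorem Neuron.mean_exp_apply {d m : ℕ} {s : ℝ} (θ : Neuron d m) (a : Hs s d m) :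
    θ.mean s Real.continuous_exp a
      = ∫ x, Real.exp (filterOut θ.r a x + θ.b x) ∂torusMeasure d := rfl

theorem integral_wave_smul_expFilter {d m : ℕ} {s : ℝ} {X : Type*} [TopologicalSpace X]
    [CompactSpace X] (ι : C(X, Hs s d m)) {r : (Fin d → ℤ) →₀ (Fin m → ℂ)}
    (hr : r ∈ filterSubmodule d m) (ξ : Fin d → ℤ) (c : ℂ) (hc : ‖c‖ ≤ 1) :
    ∫ x, wave ξ c x • (expFilter ι r).curry x ∂torusMeasure d
      = ((Neuron.ofFilterWave r hr ξ c hc).mean s Real.continuous_exp).comp ι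
        - (2 : ℝ) • ((Neuron.ofFilter r hr).mean s Real.continuous_exp).comp ι := by
  have hint : Integrable (fun x => wave ξ c x • (expFilter ι r).curry x) (torusMeasure d) :=
    continuous_integrable_torus ((wave ξ c).continuous.smul (expFilter ι r).curry.continuous)
  ext a
  have h3 : (∫ x, wave ξ c x • (expFilter ι r).curry x ∂torusMeasure d) a
      = ∫ x, wave ξ c x * Real.exp (filterOut r (ι a) x) ∂torusMeasure d :=
    ((ContinuousMap.evalCLM ℝ a).integral_comp_comm hint).symm
  rw [h3, ContinuousMap.sub_apply, ContinuousMap.smul_apply, smul_eq_mul,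
    ContinuousMap.comp_apply, ContinuousMap.comp_apply, Neuron.mean_exp_apply,
    Neuron.mean_exp_apply]
  have hc1 := continuous_filterOut_apply r (ι a)
  have hc2 := hc1.rexp
  have h4 : ∀ x, Real.exp (filterOut r (ι a) x + Real.log (2 + wave ξ c x))
      = Real.exp (filterOut r (ι a) x) * (2 + wave ξ c x) := by
    intro x
    have := (abs_le.1 (abs_wave_le ξ c x)).1
    rw [Real.exp_add, Real.exp_log (by linarith)]
  simp only [Neuron.ofFilterWave, Neuron.ofFilter, ContinuousMap.coe_mk, h4,
    ContinuousMap.zero_apply, add_zero]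
  have hi1 : Integrable (fun x => Real.exp (filterOut r (ι a) x) * (2 + wave ξ c x))
      (torusMeasure d) :=
    continuous_integrable_torus (hc2.mul (continuous_const.add (wave ξ c).continuous))
  have hi2 : Integrable (fun x => 2 * Real.exp (filterOut r (ι a) x)) (torusMeasure d) :=
    continuous_integrable_torus (continuous_const.mul hc2)
  rw [← integral_const_mul, ← integral_sub hi1 hi2]
  refine integral_congr_ae (Eventually.of_forall fun x => ?_)
  simp only
  ring

/-- Point evaluations of `exp (r ∗ a)` are limits of averaged neurons: by the Hahn-Banach theorem it
suffices to test against a functional that annihilates the averaged neurons, and by choice of the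
bias all Fourier coefficients of the resulting function on the torus vanish. -/
theorem expFilter_mem_closure {d m : ℕ} {s : ℝ} {σ : ℝ → ℝ} (hσ : Continuous σ)
    (hpoly : ¬ ∃ p : ℝ[X], ∀ x, σ x = p.eval x) {X : Type*}
    [TopologicalSpace X] [CompactSpace X] (ι : C(X, Hs s d m))
    {r : (Fin d → ℤ) →₀ (Fin m → ℂ)} (hr : r ∈ filterSubmodule d m) (x : Torus d) :
    (expFilter ι r).curry x ∈ (Submodule.span ℝ
      (range fun θ : Neuron d m => (θ.mean s hσ).comp ι)).topologicalClosure := by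
  have hmem : ∀ θ : Neuron d m, (θ.mean s Real.continuous_exp).comp ι ∈ (Submodule.span ℝ
      (range fun θ : Neuron d m => (θ.mean s hσ).comp ι)).topologicalClosure := fun θ =>
    Neuron.mean_mem_closure hσ hpoly _ ι θ
  set M := (Submodule.span ℝ
    (range fun θ : Neuron d m => (θ.mean s hσ).comp ι)).topologicalClosure with hM
  refine mem_of_forall_dual_eq_zero (Submodule.isClosed_topologicalClosure _) fun Λ hΛ => ?_
  let h : C(Torus d, ℝ) := ⟨fun x => Λ ((expFilter ι r).curry x),
    Λ.continuous.comp (expFilter ι r).curry.continuous⟩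
  have hh : h = 0 := by
    refine eq_zero_of_integral_wave h fun ξ c hc => ?_
    have hint : Integrable (fun x => wave ξ c x • (expFilter ι r).curry x) (torusMeasure d) :=
      continuous_integrable_torus ((wave ξ c).continuous.smul (expFilter ι r).curry.continuous)
    have h1 : ∫ x, wave ξ c x * h x ∂torusMeasure d
        = Λ (∫ x, wave ξ c x • (expFilter ι r).curry x ∂torusMeasure d) := by
      rw [← Λ.integral_comp_comm hint]
      simp [h]
    rw [h1, integral_wave_smul_expFilter ι hr ξ c hc]
    exact hΛ _ (M.sub_mem (hmem _) (M.smul_mem _ (hmem _)))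
  exact DFunLike.congr_fun hh x

/-- Linear combinations of averaged neurons are dense in `C(X)`, for a compact space `X` of
inputs. -/
theorem mem_closure_span_mean {d m : ℕ} {s : ℝ} {σ : ℝ → ℝ} (hσ : Continuous σ)
    (hpoly : ¬ ∃ p : ℝ[X], ∀ x, σ x = p.eval x) {X : Type*}
    [TopologicalSpace X] [CompactSpace X] (ι : C(X, Hs s d m))
    (hι : Function.Injective ι) (φ : C(X, ℝ)) :
    φ ∈ (Submodule.span ℝ
      (range fun θ : Neuron d m => (θ.mean s hσ).comp ι)).topologicalClosure := by
  let S : Submonoid C(X, ℝ) :=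
    { carrier := {φ | ∃ r ∈ filterSubmodule d m, (expFilter ι r).curry 0 = φ}
      one_mem' := ⟨0, Submodule.zero_mem _, by
        ext a
        simp [expFilter_apply, filterOut_zero]⟩
      mul_mem' := by
        rintro _ _ ⟨r, hr, rfl⟩ ⟨r', hr', rfl⟩
        refine ⟨r + r', Submodule.add_mem _ hr hr', ?_⟩
        ext a
        simp only [ContinuousMap.mul_apply, ContinuousMap.curry_apply, expFilter_apply,
          filterOut_add, Real.exp_add] }
  have hsep : ∀ a a' : X, a ≠ a' → ∃ ψ ∈ S, ψ a ≠ ψ a' := by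
    intro a a' haa'
    obtain ⟨r, hr, hne⟩ := exists_filterOut_zero_ne (hι.ne haa')
    refine ⟨(expFilter ι r).curry 0, ⟨r, hr, rfl⟩, fun h => hne ?_⟩
    simpa only [ContinuousMap.curry_apply, expFilter_apply, Real.exp_eq_exp] using h
  have h1 := mem_closure_span_of_separatesPoints S hsep φ
  have h2 : Submodule.span ℝ (S : Set C(X, ℝ)) ≤ (Submodule.span ℝ
      (range fun θ : Neuron d m => (θ.mean s hσ).comp ι)).topologicalClosure := by
    rw [Submodule.span_le]
    rintro _ ⟨r, hr, rfl⟩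
    exact expFilter_mem_closure hσ hpoly ι hr 0
  exact closure_minimal h2 (Submodule.isClosed_topologicalClosure _) h1

/-! ### Density of the outputs of the last layer -/

/-- Multiples `χ • v` of constants span a dense subspace of `C(Z, E)`, by a partition of unity. -/
theorem mem_of_forall_smul_const_mem {Z E : Type*} [MetricSpace Z] [CompactSpace Z]
    [NormedAddCommGroup E] [NormedSpace ℝ E] {M : Submodule ℝ C(Z, E)}
    (hM : IsClosed (M : Set C(Z, E)))
    (h : ∀ (χ : C(Z, ℝ)) (v : E), (⟨fun z => χ z • v, by fun_prop⟩ : C(Z, E)) ∈ M) (Φ : C(Z, E)) :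
    Φ ∈ M := by
  rw [← SetLike.mem_coe, ← hM.closure_eq, Metric.mem_closure_iff]
  intro ε hε
  let U : Z → Set Z := fun z => {z' | dist (Φ z') (Φ z) < ε / 2}
  have hU : ∀ z, IsOpen (U z) := fun z =>
    isOpen_lt (Φ.continuous.dist continuous_const) continuous_const
  obtain ⟨t, ht⟩ := isCompact_univ.elim_finite_subcover U hU
    (fun z _ => mem_iUnion.2 ⟨z, by simp [U, hε]⟩)
  obtain ⟨f, hf⟩ := PartitionOfUnity.exists_isSubordinate isClosed_univ (fun z : t => U z)
    (fun z => hU z) (fun z hz => by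
      obtain ⟨i, hi, hz'⟩ := mem_iUnion₂.1 (ht hz)
      exact mem_iUnion.2 ⟨⟨i, hi⟩, hz'⟩)
  refine ⟨∑ z : t, (⟨fun z' => f z z' • Φ z, by fun_prop⟩ : C(Z, E)),
    M.sum_mem fun z _ => h (f z) (Φ z), ?_⟩
  refine lt_of_le_of_lt ((ContinuousMap.dist_le (half_pos hε).le).2 fun z => ?_) (half_lt_self hε)
  have hone : ∑ i : t, f i z = 1 := by
    rw [← finsum_eq_sum_of_fintype]
    exact f.sum_eq_one (mem_univ z)
  rw [ContinuousMap.sum_apply, dist_eq_norm]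
  simp only [ContinuousMap.coe_mk]
  have h1 : Φ z - ∑ i : t, f i z • Φ i = ∑ i : t, f i z • (Φ z - Φ i) := by
    simp only [smul_sub, Finset.sum_sub_distrib, ← Finset.sum_smul, hone, one_smul]
  rw [h1]
  refine (norm_sum_le _ _).trans ?_
  calc ∑ i : t, ‖f i z • (Φ z - Φ i)‖ ≤ ∑ i : t, f i z * (ε / 2) := by
        refine Finset.sum_le_sum fun i _ => ?_
        rw [norm_smul, Real.norm_of_nonneg (f.nonneg i z)]
        rcases eq_or_ne (f i z) 0 with h0 | h0
        · simp [h0]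
        · refine mul_le_mul_of_nonneg_left ?_ (f.nonneg i z)
          rw [← dist_eq_norm]
          exact (hf i (subset_tsupport _ h0)).le
    _ = ε / 2 := by rw [← Finset.sum_mul, hone, one_mul]

variable {X Y : Type*} [MetricSpace X] [MetricSpace Y]

/-- The map `(x, y) ↦ f(η(x) + ψ(y) g)` into the Sobolev space, where `g` is a plane wave in one
component. -/
def outElem {d k m : ℕ} {s : ℝ} (hs : s ≤ k) {f : ℝ → ℝ} (hf : ContDiff ℝ k f)
    (q : (Fin d → ℤ) × ℂ × Fin m) (η : C(X, ℝ)) (ψ : C(Y, ℝ)) : C(X × Y, Hs s d m) :=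
  ⟨fun p => waveHs hs hf q.1 q.2.1 q.2.2 (η p.1, ψ p.2),
    (continuous_waveHs hs hf q.1 q.2.1 q.2.2).comp
      ((η.continuous.comp continuous_fst).prodMk (ψ.continuous.comp continuous_snd))⟩

theorem continuous_outElem [LocallyCompactSpace X] {d k m : ℕ} {s : ℝ} (hs : s ≤ k)
    {f : ℝ → ℝ} (hf : ContDiff ℝ k f) (q : (Fin d → ℤ) × ℂ × Fin m) (ψ : C(Y, ℝ)) :
    Continuous fun η : C(X, ℝ) => outElem hs hf q η ψ := by
  refine ContinuousMap.continuous_of_continuous_uncurry _ ?_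
  exact (continuous_waveHs hs hf q.1 q.2.1 q.2.2).comp
    (by fun_prop : Continuous fun p : C(X, ℝ) × X × Y => (p.1 p.2.1, ψ p.2.2))

variable [CompactSpace X] [CompactSpace Y]

/-- The square function is a limit of linear combinations of `z ↦ σ(w z + b)` in the `C^k` sense,
and the `H^s` norm of a composition is controlled by the `C^k` norm of the outer function. -/
theorem outElem_sq_mem {d k m : ℕ} {s : ℝ} (hs : s ≤ k) {σ : ℝ → ℝ} (hσ : ContDiff ℝ k σ)
    (hpoly : ¬ ∃ p : ℝ[X], ∀ x, σ x = p.eval x)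
    {M : Submodule ℝ C(X × Y, Hs s d m)} (hM : IsClosed (M : Set C(X × Y, Hs s d m)))
    (h : ∀ q η ψ, outElem hs hσ q η ψ ∈ M) (h2 : ContDiff ℝ k fun z : ℝ => z ^ 2)
    (q : (Fin d → ℤ) × ℂ × Fin m) (η : C(X, ℝ)) (ψ : C(Y, ℝ)) : outElem hs h2 q η ψ ∈ M := by
  rw [← SetLike.mem_coe, ← hM.closure_eq, Metric.mem_closure_iff]
  intro ε hε
  set R := ‖η‖ + ‖ψ‖ * ‖q.2.1‖ with hR
  have hR0 : 0 ≤ R := by positivity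
  set C : ℝ := (d + 1) ^ (k + 1) * (1 + ∑ i, |2 * Real.pi * q.1 i|) ^ k *
      (k.factorial * (1 + R) ^ k) with hC
  have hCpos : 0 < C := by positivity
  obtain ⟨n, c, w, b, hcwb⟩ := exists_ridge_approx hσ hpoly (Polynomial.X ^ 2) R
    (show 0 < ε / (2 * C) by positivity)
  simp only [eval_pow, eval_X] at hcwb
  have hfg : ContDiff ℝ k fun z => z ^ 2 - ∑ l, c l * σ (w l * z + b l) :=
    h2.sub (ContDiff.sum fun l _ => contDiff_const.mul (hσ.comp (by fun_prop)))
  refine ⟨∑ l, c l • outElem hs hσ q (w l • η + ContinuousMap.const _ (b l)) (w l • ψ),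
    M.sum_mem fun l _ => M.smul_mem _ (h _ _ _), ?_⟩
  refine lt_of_le_of_lt ((ContinuousMap.dist_le (C := ε / 2) (by positivity)).2 fun p => ?_)
    (half_lt_self hε)
  rw [dist_eq_norm, ContinuousMap.sum_apply]
  have h3 := waveHs_sub_sum hs h2 hσ q.1 q.2.1 q.2.2 (η p.1, ψ p.2) c w b hfg
  have h4 := norm_waveHs_le hs hfg q.1 q.2.1 q.2.2 (η p.1, ψ p.2) (R := R) (N := ε / (2 * C)) (by
    rw [abs_mul, abs_norm]
    exact add_le_add (η.norm_coe_le_norm _)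
      (mul_le_mul_of_nonneg_right (ψ.norm_coe_le_norm _) (norm_nonneg _)))
    (fun j hj z hz => (hcwb j hj z hz).le)
  rw [h3] at h4
  refine h4.trans (le_of_eq ?_)
  rw [← mul_assoc (_ * _ : ℝ) (_ * _ : ℝ), ← hC]
  field_simp

/-- A multiple of a plane wave by a continuous function of `(x, y)` is in the closed span: for
`η(x) ψ(y)` by polarization, and in general by the Stone-Weierstrass theorem. -/
theorem outElem_mul_mem {d k m : ℕ} {s : ℝ} (hs : s ≤ k) {σ : ℝ → ℝ} (hσ : ContDiff ℝ k σ)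
    (hpoly : ¬ ∃ p : ℝ[X], ∀ x, σ x = p.eval x)
    {M : Submodule ℝ C(X × Y, Hs s d m)} (hM : IsClosed (M : Set C(X × Y, Hs s d m)))
    (h : ∀ q η ψ, outElem hs hσ q η ψ ∈ M)
    (q : (Fin d → ℤ) × ℂ × Fin m) (χ : C(X × Y, ℝ)) :
    (⟨fun z => χ z • waveHs hs (contDiff_id (𝕜 := ℝ) (E := ℝ)) q.1 q.2.1 q.2.2 (0, 1),
      by fun_prop⟩ : C(X × Y, Hs s d m)) ∈ M := by
  set v := waveHs hs (contDiff_id (𝕜 := ℝ) (E := ℝ)) q.1 q.2.1 q.2.2 (0, 1)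
  have h2 : ContDiff ℝ k fun z : ℝ => z ^ 2 := by fun_prop
  let S : Submonoid C(X × Y, ℝ) :=
    { carrier := {χ | ∃ (η : C(X, ℝ)) (ψ : C(Y, ℝ)), ∀ p, χ p = η p.1 * ψ p.2}
      one_mem' := ⟨1, 1, fun p => by simp⟩
      mul_mem' := by
        rintro χ χ' ⟨η, ψ, h⟩ ⟨η', ψ', h'⟩
        refine ⟨η * η', ψ * ψ', fun p => ?_⟩
        simp only [ContinuousMap.mul_apply, h, h']
        ring }
  have hsep : ∀ p p' : X × Y, p ≠ p' → ∃ χ ∈ S, χ p ≠ χ p' := by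
    intro p p' hne
    by_cases h1 : p.1 = p'.1
    · have h2 : p.2 ≠ p'.2 := fun h2 => hne (Prod.ext h1 h2)
      refine ⟨⟨fun z => dist z.2 p'.2, by fun_prop⟩, ⟨1, ⟨fun y => dist y p'.2, by fun_prop⟩,
        fun z => by simp⟩, ?_⟩
      simpa using h2
    · refine ⟨⟨fun z => dist z.1 p'.1, by fun_prop⟩, ⟨⟨fun y => dist y p'.1, by fun_prop⟩, 1,
        fun z => by simp⟩, ?_⟩
      simpa using h1
  let L : C(X × Y, ℝ) →ₗ[ℝ] C(X × Y, Hs s d m) :=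
    { toFun := fun χ => ⟨fun z => χ z • v, by fun_prop⟩
      map_add' := fun χ χ' => by
        ext1 z
        exact add_smul _ _ _
      map_smul' := fun a χ => by
        ext1 z
        exact mul_smul _ _ _ }
  have hL : Continuous L := by
    refine ContinuousMap.continuous_of_continuous_uncurry _ ?_
    exact (by fun_prop : Continuous fun p : C(X × Y, ℝ) × X × Y => p.1 p.2 • v)
  have hle : Submodule.span ℝ (S : Set C(X × Y, ℝ)) ≤ M.comap L := by
    rw [Submodule.span_le]
    rintro χ ⟨η, ψ, hχ⟩
    have h3 : L χ = (4 : ℝ)⁻¹ • (outElem hs h2 q η ψ - outElem hs h2 q η (-ψ)) := by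
      ext1 z
      have h5 := waveHs_sq_sub hs q.1 q.2.1 q.2.2 h2 (η z.1) (ψ z.2)
      change χ z • v = (4 : ℝ)⁻¹ • (waveHs hs h2 q.1 q.2.1 q.2.2 (η z.1, ψ z.2)
        - waveHs hs h2 q.1 q.2.1 q.2.2 (η z.1, -ψ z.2))
      rw [h5, smul_smul, hχ, inv_mul_cancel_left₀ (by norm_num)]
    change L χ ∈ M
    rw [h3]
    exact M.smul_mem _ (M.sub_mem (outElem_sq_mem hs hσ hpoly hM h h2 q η ψ)
      (outElem_sq_mem hs hσ hpoly hM h h2 q η (-ψ)))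
  exact closure_minimal hle (hM.preimage hL) (mem_closure_span_of_separatesPoints S hsep χ)

/-- Linear combinations of the functions `σ(η(x) + ψ(y) g)`, where `η` runs through a dense set of
functions, are dense in `C(X × Y; H^s)`. -/
theorem mem_closure_span_outElem {d k m : ℕ} {s : ℝ} (hs : s ≤ k) {σ : ℝ → ℝ}
    (hσ : ContDiff ℝ k σ) (hpoly : ¬ ∃ p : ℝ[X], ∀ x, σ x = p.eval x)
    {D : Set C(X, ℝ)} (hD : ∀ η, η ∈ closure D) (Φ : C(X × Y, Hs s d m)) :
    Φ ∈ (Submodule.span ℝ {Φ : C(X × Y, Hs s d m) |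
      ∃ q, ∃ η ∈ D, ∃ ψ, outElem hs hσ q η ψ = Φ}).topologicalClosure := by
  set M := (Submodule.span ℝ {Φ : C(X × Y, Hs s d m) |
      ∃ q, ∃ η ∈ D, ∃ ψ, outElem hs hσ q η ψ = Φ}).topologicalClosure
  have hM : IsClosed (M : Set C(X × Y, Hs s d m)) := Submodule.isClosed_topologicalClosure _
  have h1 : ∀ q η ψ, outElem hs hσ q η ψ ∈ M := by
    intro q η ψ
    have hsub : D ⊆ (fun η => outElem hs hσ q η ψ) ⁻¹' (M : Set C(X × Y, Hs s d m)) :=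
      fun η hη => Submodule.le_topologicalClosure _ (Submodule.subset_span ⟨q, η, hη, ψ, rfl⟩)
    exact closure_minimal hsub (hM.preimage (continuous_outElem hs hσ q ψ)) (hD η)
  refine mem_of_forall_smul_const_mem hM (fun χ v => ?_) Φ
  let L : Hs s d m →ₗ[ℝ] C(X × Y, Hs s d m) :=
    { toFun := fun v => ⟨fun z => χ z • v, by fun_prop⟩
      map_add' := fun v v' => by
        ext1 z
        exact smul_add _ _ _
      map_smul' := fun a v => by
        ext1 z
        exact smul_comm _ _ _ }
  have hL : Continuous L := by
    refine ContinuousMap.continuous_of_continuous_uncurry _ ?_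
    exact (by fun_prop : Continuous fun p : Hs s d m × X × Y => χ p.2 • p.1)
  have hle : Submodule.span ℝ (range fun q : (Fin d → ℤ) × ℂ × Fin m =>
      waveHs hs (contDiff_id (𝕜 := ℝ) (E := ℝ)) q.1 q.2.1 q.2.2 (0, 1)) ≤ M.comap L := by
    rw [Submodule.span_le]
    rintro _ ⟨q, rfl⟩
    exact outElem_mul_mem hs hσ hpoly hM h1 q χ
  exact closure_minimal hle (hM.preimage hL) (mem_closure_span_waveHs hs v)

/-! ### The two layers of the network -/

theorem Layer.kernelℂ_apply {T : ℝ} {d n : ℕ} (l : Layer T d n) (t : Icc (0 : ℝ) T)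
    (v : Torus d → Fin n → ℝ) (x : Torus d) (i : Fin n) {S : Finset (Fin d → ℤ)}
    (hS : l.R.support ⊆ S) : l.kernelℂ t v x i = ∑ ξ ∈ S, UnitAddTorus.mFourier ξ x *
      ∑ j, l.φ ξ t * l.R ξ i j * fourierCoeffReal (fun y => v y j) ξ := by
  rw [Layer.kernelℂ, Finset.sum_apply]
  simp only [Pi.smul_apply, smul_eq_mul, Matrix.mulVec, dotProduct, Matrix.smul_apply]
  refine Finset.sum_subset hS fun ξ _ hξ => ?_
  simp [Finsupp.notMem_support_iff.1 hξ]

/-- A layer without the local linear term and with a time-independent kernel. -/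
def Layer.ofKernel {T : ℝ} {d n : ℕ} (b : Torus d → Fin n → ℝ)
    (hb : ContDiff ℝ ∞ fun y : Fin d → ℝ => b fun i => (y i : UnitAddCircle))
    (ψ : C(Icc (0 : ℝ) T, Fin n → ℝ)) (R : (Fin d → ℤ) →₀ Matrix (Fin n) (Fin n) ℂ)
    (hR : ∀ ξ, R (-ξ) = (R ξ).map (starRingEnd ℂ)) : Layer T d n :=
  ⟨0, 0, b, hb, ψ, R, hR, 1, fun _ => rfl⟩

theorem Layer.ofKernel_apply {T : ℝ} {d n : ℕ} {b : Torus d → Fin n → ℝ}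
    {hb : ContDiff ℝ ∞ fun y : Fin d → ℝ => b fun i => (y i : UnitAddCircle)}
    {ψ : C(Icc (0 : ℝ) T, Fin n → ℝ)} {R : (Fin d → ℤ) →₀ Matrix (Fin n) (Fin n) ℂ}
    {hR : ∀ ξ, R (-ξ) = (R ξ).map (starRingEnd ℂ)} (σ : ℝ → ℝ) (t : Icc (0 : ℝ) T)
    (v : Torus d → Fin n → ℝ) (x : Torus d) (i : Fin n) {S : Finset (Fin d → ℤ)}
    (hS : R.support ⊆ S) :
    (Layer.ofKernel b hb ψ R hR).apply σ t v x i = σ (ψ t i * b x i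
      + ∑ ξ ∈ S, (UnitAddTorus.mFourier ξ x *
          ∑ j, R ξ i j * fourierCoeffReal (fun y => v y j) ξ).re) := by
  rw [Layer.apply, Layer.kernelℂ_apply _ _ _ _ _ hS, Complex.re_sum]
  simp [Layer.ofKernel]

section Network

variable {d m n : ℕ} {ι₁ ι₂ : Type*} (e : Fin m ⊕ ι₁ ⊕ ι₂ ≃ Fin n) {T : ℝ}

/-- The kernel of the first layer, which applies the filters of the neurons `θ` to the channels of
the input. The channels of the network are the `m` channels of the input, one channel for each
neuron of the first layer, and one channel for each neuron of the second layer. -/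
def firstKernel (θ : ι₁ → Neuron d m) (ξ : Fin d → ℤ) :
    Matrix (Fin m ⊕ ι₁ ⊕ ι₂) (Fin m ⊕ ι₁ ⊕ ι₂) ℂ
  | .inr (.inl l), .inl c => (θ l).r ξ c
  | _, _ => 0

/-- The bias of the first layer. -/
def firstBias (θ : ι₁ → Neuron d m) (x : Torus d) : Fin m ⊕ ι₁ ⊕ ι₂ → ℝ
  | .inr (.inl l) => (θ l).b x
  | _ => 0

/-- The preactivation of the first layer. -/
def firstPre {s : ℝ} (θ : ι₁ → Neuron d m) (a : Hs s d m) (x : Torus d) : Fin m ⊕ ι₁ ⊕ ι₂ → ℝ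
  | .inr (.inl l) => filterOut (θ l).r a x + (θ l).b x
  | _ => 0

theorem continuous_firstPre {s : ℝ} (θ : ι₁ → Neuron d m) (a : Hs s d m)
    (i : Fin m ⊕ ι₁ ⊕ ι₂) : Continuous fun x => firstPre θ a x i := by
  rcases i with c | l | j
  · exact continuous_const
  · exact (continuous_filterOut_apply _ a).add (θ l).b.continuous
  · exact continuous_const

/-- The kernel of the second layer at the zero mode: a linear combination of the averages of the
neurons of the first layer. -/
def secondKernel (m : ℕ) (A : ι₂ → ι₁ → ℝ) : Matrix (Fin m ⊕ ι₁ ⊕ ι₂) (Fin m ⊕ ι₁ ⊕ ι₂) ℂ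
  | .inr (.inr j), .inr (.inl l) => A j l
  | _, _ => 0

/-- The bias of the second layer consists of plane waves. -/
def secondBias (m : ℕ) (ι₁ : Type*) {r : ℕ} (q : ι₂ → (Fin d → ℤ) × ℂ × Fin r) (x : Torus d) :
    Fin m ⊕ ι₁ ⊕ ι₂ → ℝ
  | .inr (.inr j) => wave (q j).1 (q j).2.1 x
  | _ => 0

/-- The time modulation of the bias of the second layer. -/
def secondModulation {Y : Type*} [TopologicalSpace Y] (m : ℕ) (ι₁ : Type*) (ψ : ι₂ → C(Y, ℝ))
    (t : Y) : Fin m ⊕ ι₁ ⊕ ι₂ → ℝ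
  | .inr (.inr j) => ψ j t
  | _ => 0

/-- The lifting copies the input to its channels. -/
def liftMatrix : Matrix (Fin n) (Fin m) ℝ :=
  Matrix.of fun i c => Sum.elim (fun c' => if c = c' then 1 else 0) 0 (e.symm i)

theorem liftMatrix_mulVec (v : Fin m → ℝ) (i : Fin n) :
    (liftMatrix e *ᵥ v) i = Sum.elim v 0 (e.symm i) := by
  rw [Matrix.mulVec, dotProduct]
  rcases h : e.symm i with c | l <;> simp [liftMatrix, h]

variable [Fintype ι₁]

/-- The functional that the second layer applies to the input. -/
def meanComb (s : ℝ) {σ : ℝ → ℝ} (hσ : Continuous σ) (θ : ι₁ → Neuron d m) (w : ι₁ → ℝ) :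
    C(Hs s d m, ℝ) := ∑ l, w l • (θ l).mean s hσ

/-- The preactivation of the second layer. -/
def secondPre {s : ℝ} {σ : ℝ → ℝ} (hσ : Continuous σ) {Y : Type*} [TopologicalSpace Y] {r : ℕ}
    (θ : ι₁ → Neuron d m) (q : ι₂ → (Fin d → ℤ) × ℂ × Fin r) (ψ : ι₂ → C(Y, ℝ))
    (A : ι₂ → ι₁ → ℝ) (a : Hs s d m) (t : Y) (x : Torus d) : Fin m ⊕ ι₁ ⊕ ι₂ → ℝ
  | .inr (.inr j) => meanComb s hσ θ (A j) a + ψ j t * wave (q j).1 (q j).2.1 x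
  | _ => 0

theorem continuous_secondPre {s : ℝ} {σ : ℝ → ℝ} (hσ : Continuous σ) {Y : Type*}
    [TopologicalSpace Y] {r : ℕ} (θ : ι₁ → Neuron d m) (q : ι₂ → (Fin d → ℤ) × ℂ × Fin r)
    (ψ : ι₂ → C(Y, ℝ)) (A : ι₂ → ι₁ → ℝ) (a : Hs s d m)
    (i : Fin m ⊕ ι₁ ⊕ ι₂) :
    Continuous fun p : Y × Torus d => secondPre hσ θ q ψ A a p.1 p.2 i := by
  rcases i with c | l | j
  · exact continuous_const
  · exact continuous_const
  · exact continuous_const.add (((ψ j).continuous.comp continuous_fst).mul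
      ((wave _ _).continuous.comp continuous_snd))

variable [Fintype ι₂]

open Classical in
/-- The first layer evaluates the neurons `θ`. -/
def firstLayer (T : ℝ) (θ : ι₁ → Neuron d m) : Layer T d n :=
  .ofKernel (fun x i => firstBias θ x (e.symm i))
    (contDiff_pi.2 fun i => by
      rcases e.symm i with c | l | j
      · exact contDiff_const
      · exact (θ l).b_smooth
      · exact contDiff_const) 1
    (Finsupp.onFinset (Finset.univ.biUnion fun l => (θ l).r.support)
      (fun ξ => (firstKernel θ ξ).submatrix e.symm e.symm) (by
        intro ξ h
        by_contra hξ
        refine h (Matrix.ext fun i j => ?_)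
        rw [Matrix.submatrix_apply, Matrix.zero_apply]
        rcases e.symm i with c | l | c
        · rfl
        · rcases e.symm j with c | l | c
          · by_contra h1
            refine hξ (Finset.mem_biUnion.2 ⟨l, Finset.mem_univ l, Finsupp.mem_support_iff.2 ?_⟩)
            intro h0
            exact h1 (by simp [firstKernel, h0])
          · rfl
          · rfl
        · rfl))
    (fun ξ => Matrix.ext fun i j => by
      simp only [Finsupp.onFinset_apply, Matrix.submatrix_apply, Matrix.map_apply]
      rcases e.symm i with c | l | c <;> rcases e.symm j with c' | l' | c' <;>
        simp only [firstKernel, map_zero]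
      exact (θ l).r_mem ξ c')

/-- The second layer evaluates `σ (∑ l, A j l * mean (θ l) + ψ j * g j)` with plane waves `g j`. -/
def secondLayer {r : ℕ} (q : ι₂ → (Fin d → ℤ) × ℂ × Fin r) (ψ : ι₂ → C(Icc (0 : ℝ) T, ℝ))
    (A : ι₂ → ι₁ → ℝ) : Layer T d n :=
  .ofKernel (fun x i => secondBias m ι₁ q x (e.symm i))
    (contDiff_pi.2 fun i => by
      rcases e.symm i with c | l | j
      · exact contDiff_const
      · exact contDiff_const
      · exact contDiff_wave _ _)
    ⟨fun t i => secondModulation m ι₁ ψ t (e.symm i), continuous_pi fun i => by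
      rcases e.symm i with c | l | j
      · exact continuous_const
      · exact continuous_const
      · exact (ψ j).continuous⟩
    (Finsupp.single 0 ((secondKernel m A).submatrix e.symm e.symm))
    (fun ξ => Matrix.ext fun i j => by
      by_cases hξ : ξ = 0
      · subst hξ
        simp only [neg_zero, Finsupp.single_eq_same, Matrix.map_apply, Matrix.submatrix_apply]
        rcases e.symm i with c | l | c <;> rcases e.symm j with c' | l' | c' <;>
          simp [secondKernel]
      · rw [Finsupp.single_eq_of_ne hξ, Finsupp.single_eq_of_ne (neg_ne_zero.2 hξ)]
        simp)

/-- The output channel `o` is the sum of the channels of the second layer that carry the component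
`o`, with the weights `c`. -/
def projMatrix {r : ℕ} (q : ι₂ → (Fin d → ℤ) × ℂ × Fin r) (c : ι₂ → ℝ) :
    Matrix (Fin r) (Fin n) ℝ :=
  Matrix.of fun o i => Sum.elim 0 (Sum.elim 0 fun j => if o = (q j).2.2 then c j else 0) (e.symm i)

theorem projMatrix_mulVec {r : ℕ} (q : ι₂ → (Fin d → ℤ) × ℂ × Fin r) (c : ι₂ → ℝ) (v : Fin n → ℝ)
    (o : Fin r) : (projMatrix e q c *ᵥ v) o
      = ∑ j, if o = (q j).2.2 then c j * v (e (.inr (.inr j))) else 0 := by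
  rw [Matrix.mulVec, dotProduct, ← e.sum_comp]
  simp [projMatrix]

theorem firstLayer_apply {s : ℝ} (σ : ℝ → ℝ) (θ : ι₁ → Neuron d m) (t : Icc (0 : ℝ) T)
    (a : Hs s d m) (x : Torus d) (i : Fin n) :
    (firstLayer e T θ).apply σ t (fun x => liftMatrix e *ᵥ (a.toL2 x).ofLp) x i
      = σ (firstPre θ a x (e.symm i)) := by
  classical
  rw [firstLayer, Layer.ofKernel_apply (S := Finset.univ.biUnion fun l => (θ l).r.support)]
  swap
  · intro ξ hξ
    simpa using Finsupp.support_onFinset_subset hξ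
  congr 1
  simp only [← e.sum_comp (M := ℂ), liftMatrix_mulVec, e.symm_apply_apply, Fintype.sum_sum_type,
    Finsupp.onFinset_apply, Matrix.submatrix_apply, ContinuousMap.one_apply, Pi.one_apply, one_mul]
  rcases e.symm i with c | l | j
  · simp [firstKernel, firstBias, firstPre]
  · simp only [firstKernel, firstBias, firstPre, zero_mul, Finset.sum_const_zero, add_zero,
      Sum.elim_inl]
    rw [add_comm]
    congr 1
    refine (Finset.sum_subset (Finset.subset_biUnion_of_mem (fun l => (θ l).r.support)
      (Finset.mem_univ l)) fun ξ _ hξ => ?_).symm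
    simp [Finsupp.notMem_support_iff.1 hξ]
  · simp [firstKernel, firstBias, firstPre]

theorem fourierCoeffReal_zero (f : Torus d → ℝ) :
    fourierCoeffReal f 0 = ((∫ x, f x ∂torusMeasure d : ℝ) : ℂ) := by
  rw [fourierCoeffReal_eq, ← integral_complex_ofReal]
  simp [UnitAddTorus.mFourier_zero]

theorem secondLayer_apply {s : ℝ} {σ : ℝ → ℝ} (hσ : Continuous σ) {r : ℕ} (θ : ι₁ → Neuron d m)
    (q : ι₂ → (Fin d → ℤ) × ℂ × Fin r) (ψ : ι₂ → C(Icc (0 : ℝ) T, ℝ)) (A : ι₂ → ι₁ → ℝ)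
    (a : Hs s d m) (t : Icc (0 : ℝ) T) (x : Torus d) (i : Fin n) :
    (secondLayer e q ψ A).apply σ t (fun x i => σ (firstPre θ a x (e.symm i))) x i
      = σ (secondPre hσ θ q ψ A a t x (e.symm i)) := by
  classical
  rw [secondLayer, Layer.ofKernel_apply (S := {0}) _ _ _ _ _ Finsupp.support_single_subset]
  congr 1
  simp only [← e.sum_comp (M := ℂ), e.symm_apply_apply, Fintype.sum_sum_type,
    Finsupp.single_eq_same, Matrix.submatrix_apply, ContinuousMap.coe_mk, Finset.sum_singleton,
    UnitAddTorus.mFourier_zero, ContinuousMap.one_apply, one_mul, fourierCoeffReal_zero]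
  rcases e.symm i with c | l | j
  · simp [secondKernel, secondBias, secondPre]
  · simp [secondKernel, secondBias, secondPre]
  · simp only [secondKernel, secondBias, secondPre, secondModulation, zero_mul,
      Finset.sum_const_zero, add_zero, zero_add, firstPre]
    rw [add_comm, meanComb, ContinuousMap.sum_apply]
    congr 1
    rw [Complex.re_sum]
    refine Finset.sum_congr rfl fun l _ => ?_
    rw [← Complex.ofReal_mul, Complex.ofReal_re]
    rfl

/-- The network with the layers above. -/
def network {r : ℕ} (θ : ι₁ → Neuron d m) (q : ι₂ → (Fin d → ℤ) × ℂ × Fin r)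
    (ψ : ι₂ → C(Icc (0 : ℝ) T, ℝ)) (A : ι₂ → ι₁ → ℝ) (c : ι₂ → ℝ) : CTFNO T d m r where
  n := n
  P := liftMatrix e
  L := 2
  L_pos := two_pos
  layer := ![firstLayer e T θ, secondLayer e q ψ A]
  Q := projMatrix e q c

theorem network_state_one {s : ℝ} (σ : ℝ → ℝ) {r : ℕ} (θ : ι₁ → Neuron d m)
    (q : ι₂ → (Fin d → ℤ) × ℂ × Fin r) (ψ : ι₂ → C(Icc (0 : ℝ) T, ℝ)) (A : ι₂ → ι₁ → ℝ)
    (c : ι₂ → ℝ) (a : Hs s d m) (t : Icc (0 : ℝ) T) :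
    (network e θ q ψ A c).state σ a.toL2 t 1 = fun x i => σ (firstPre θ a x (e.symm i)) :=
  funext fun x => funext fun i => firstLayer_apply e σ θ t a x i

theorem network_state_two {s : ℝ} {σ : ℝ → ℝ} (hσ : Continuous σ) {r : ℕ} (θ : ι₁ → Neuron d m)
    (q : ι₂ → (Fin d → ℤ) × ℂ × Fin r) (ψ : ι₂ → C(Icc (0 : ℝ) T, ℝ)) (A : ι₂ → ι₁ → ℝ)
    (c : ι₂ → ℝ) (a : Hs s d m) (t : Icc (0 : ℝ) T) :
    (network e θ q ψ A c).state σ a.toL2 t 2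
      = fun x i => σ (secondPre hσ θ q ψ A a t x (e.symm i)) := by
  have h : (network e θ q ψ A c).state σ a.toL2 t 2
      = (secondLayer e q ψ A).apply σ t ((network e θ q ψ A c).state σ a.toL2 t 1) := rfl
  rw [h, network_state_one]
  exact funext fun x => funext fun i => secondLayer_apply e hσ θ q ψ A a t x i

theorem exists_curve_of_continuous {Y : Type*} [TopologicalSpace Y] {g : Y → Torus d → Fin n → ℝ}
    (hg : Continuous fun p : Y × Torus d => g p.1 p.2) :
    ∃ V : C(Y, L2 d n), ∀ t, (fun x => (V t x).ofLp) =ᵐ[torusMeasure d] g t := by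
  let Γ : C(Y × Torus d, EuclideanSpace ℝ (Fin n)) := ⟨fun p => WithLp.toLp 2 (g p.1 p.2),
    (PiLp.continuous_toLp 2 _).comp hg⟩
  let I := ContinuousMap.toLp (E := EuclideanSpace ℝ (Fin n)) 2 (torusMeasure d) ℝ
  refine ⟨⟨fun t => I (Γ.curry t), I.continuous.comp Γ.curry.continuous⟩, fun t => ?_⟩
  filter_upwards [ContinuousMap.coeFn_toLp (p := 2) (𝕜 := ℝ) (torusMeasure d) (Γ.curry t)]
    with x hx
  exact congrArg WithLp.ofLp hx

/-- The operator `a ↦ (t ↦ ∑ j, c j * σ(ζ j (a) + ψ j (t) g j))` is a network, for linear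
combinations `ζ j` of averaged neurons and plane waves `g j`. -/
theorem network_realizes {k r : ℕ} {s s' : ℝ} (hs' : s' ≤ k) {σ : ℝ → ℝ} (hσ : ContDiff ℝ k σ)
    (θ : ι₁ → Neuron d m) (q : ι₂ → (Fin d → ℤ) × ℂ × Fin r)
    (ψ : ι₂ → C(Icc (0 : ℝ) T, ℝ)) (A : ι₂ → ι₁ → ℝ) (c : ι₂ → ℝ) :
    (network e θ q ψ A c).Realizes σ (s := s) (∑ j, c j • outElem hs' hσ (q j)
      (meanComb s hσ.continuous θ (A j)) (ψ j)).curry := by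
  intro a
  refine ⟨fun k hk => ?_, fun t => ?_⟩
  · obtain rfl | rfl | rfl : k = 0 ∨ k = 1 ∨ k = 2 := by
      change k ≤ 2 at hk
      omega
    · let Λ : EuclideanSpace ℝ (Fin m) →L[ℝ] EuclideanSpace ℝ (Fin n) :=
        (Matrix.toLpLin 2 2 (liftMatrix e)).toContinuousLinearMap
      refine ⟨ContinuousMap.const _ (Λ.compLp a.toL2), fun t => ?_⟩
      filter_upwards [Λ.coeFn_compLp a.toL2] with x hx
      exact congrArg WithLp.ofLp hx
    · simp only [network_state_one]
      exact exists_curve_of_continuous (g := fun _ x i => σ (firstPre θ a x (e.symm i)))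
        (continuous_pi fun i => hσ.continuous.comp
          ((continuous_firstPre θ a _).comp continuous_snd))
    · simp only [network_state_two e hσ.continuous]
      exact exists_curve_of_continuous
        (g := fun t x i => σ (secondPre hσ.continuous θ q ψ A a t x (e.symm i)))
        (continuous_pi fun i => hσ.continuous.comp
          (continuous_secondPre hσ.continuous θ q ψ A a _))
  · have h1 : ((∑ j, c j • outElem hs' hσ (q j) (meanComb s hσ.continuous θ (A j)) (ψ j)).curry
        a t).toL2 = ∑ j, c j • (waveHs hs' hσ (q j).1 (q j).2.1 (q j).2.2
          (meanComb s hσ.continuous θ (A j) a, ψ j t)).toL2 := by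
      rw [ContinuousMap.curry_apply, ContinuousMap.sum_apply, map_sum]
      refine Finset.sum_congr rfl fun j _ => ?_
      rw [ContinuousMap.smul_apply, map_smul]
      rfl
    rw [h1]
    have h2 : ∀ j, ∀ᵐ x ∂torusMeasure d, (c j • (waveHs hs' hσ (q j).1 (q j).2.1 (q j).2.2
        (meanComb s hσ.continuous θ (A j) a, ψ j t)).toL2) x
          = c j • σ (meanComb s hσ.continuous θ (A j) a + ψ j t * wave (q j).1 (q j).2.1 x) •
            EuclideanSpace.single (q j).2.2 (1 : ℝ) := by
      intro j
      filter_upwards [Lp.coeFn_smul (c j) (waveHs hs' hσ (q j).1 (q j).2.1 (q j).2.2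
        (meanComb s hσ.continuous θ (A j) a, ψ j t)).toL2,
        coeFn_waveHs hs' hσ (q j).1 (q j).2.1 (q j).2.2
          (meanComb s hσ.continuous θ (A j) a, ψ j t)] with x h3 h4
      rw [h3, Pi.smul_apply, h4]
    filter_upwards [Lp.coeFn_finsetSum Finset.univ fun j =>
      c j • (waveHs hs' hσ (q j).1 (q j).2.1 (q j).2.2
        (meanComb s hσ.continuous θ (A j) a, ψ j t)).toL2, ae_all_iff.2 h2] with x h3 h4
    rw [h3]
    ext o
    have h5 : ((network e θ q ψ A c).eval σ a.toL2 t x) o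
        = (projMatrix e q c *ᵥ (network e θ q ψ A c).state σ a.toL2 t 2 x) o := rfl
    rw [h5, network_state_two e hσ.continuous, projMatrix_mulVec]
    simp [h4, secondPre, Pi.single_apply]

end Network

/-- A linear combination of functions `σ(η(x) + ψ(y) g)`, where each `η` is a linear combination of
averaged neurons restricted to a set of inputs, is the restriction of a network. -/
theorem exists_network_of_mem_span {d m k r : ℕ} {s s' T : ℝ} (hs' : s' ≤ k) {σ : ℝ → ℝ}
    (hσ : ContDiff ℝ k σ) {K : Set (Hs s d m)} {Φ : C(K × Icc (0 : ℝ) T, Hs s' d r)}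
    (hΦ : Φ ∈ Submodule.span ℝ {Φ : C(K × Icc (0 : ℝ) T, Hs s' d r) |
      ∃ q, ∃ η ∈ (Submodule.span ℝ (range fun θ : Neuron d m =>
        (θ.mean s hσ.continuous).restrict K) : Set C(K, ℝ)), ∃ ψ,
        outElem hs' hσ q η ψ = Φ}) :
    ∃ (N : CTFNO T d m r) (F : C(Hs s d m, C(Icc (0 : ℝ) T, Hs s' d r))), N.Realizes σ F ∧
      ∀ (a : K) t, F a t = Φ (a, t) := by
  classical
  obtain ⟨p, c, g, rfl⟩ := Submodule.mem_span_set'.1 hΦ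
  choose q η hη ψ hg using fun j => (g j).2
  choose A hA using fun j => Finsupp.mem_span_range_iff_exists_finsupp.1 (hη j)
  let S : Finset (Neuron d m) := Finset.univ.biUnion fun j => (A j).support
  refine ⟨_, _, network_realizes (ι₁ := S) (Fintype.equivFin _) hs' hσ (fun l => l.1) q ψ
    (fun j l => A j l) c, fun a t => ?_⟩
  rw [ContinuousMap.curry_apply, ContinuousMap.sum_apply, ContinuousMap.sum_apply]
  refine Finset.sum_congr rfl fun j _ => ?_
  rw [ContinuousMap.smul_apply, ContinuousMap.smul_apply, ← hg]
  have h1 : meanComb s hσ.continuous (fun l : S => l.1) (fun l => A j l) a = η j a := by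
    rw [← hA j, meanComb, ContinuousMap.sum_apply, Finsupp.sum_of_support_subset (s := S) _
      (Finset.subset_biUnion_of_mem (fun j => (A j).support) (Finset.mem_univ j)) _ (by simp),
      ContinuousMap.sum_apply, ← Finset.sum_coe_sort S]
    rfl
  congr 1
  change waveHs hs' hσ _ _ _ (_, _) = waveHs hs' hσ _ _ _ (_, _)
  rw [h1]

end TFNO

end

/-- Universal approximation of continuous operators `H^s(𝕋^d; ℝ^da) → C([0,T]; H^s'(𝕋^d; ℝ^du))` by
continuous-time Fourier neural operators. -/
theorem mainTheorem1 (d da du : ℕ) (T : ℝ) (hT : 0 < T) (s s' : ℝ) (hs : 0 ≤ s) (hs' : 0 ≤ s')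
    (σ : ℝ → ℝ) (k : ℕ) (hk : s' ≤ k) (hσ : ContDiff ℝ k σ)
    (hσ_poly : ¬ ∃ p : ℝ[X], ∀ x, σ x = p.eval x)
    (G : TFNO.Hs s d da → C(Set.Icc (0 : ℝ) T, TFNO.Hs s' d du)) (hG : Continuous G)
    (K : Set (TFNO.Hs s d da)) (hK : IsCompact K) (ε : ℝ) (hε : 0 < ε) :
    ∃ (N : TFNO.CTFNO T d da du) (F : TFNO.Hs s d da → C(Set.Icc (0 : ℝ) T, TFNO.Hs s' d du)),
      N.Realizes σ F ∧ Continuous F ∧ (⨆ a ∈ K, ‖G a - F a‖ₑ) < ENNReal.ofReal ε := by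
  have : CompactSpace K := isCompact_iff_compactSpace.1 hK
  let Φ : C(K × Set.Icc (0 : ℝ) T, TFNO.Hs s' d du) :=
    ContinuousMap.uncurry ⟨fun a : K => G a, hG.comp continuous_subtype_val⟩
  have hΦ := TFNO.mem_closure_span_outElem hk hσ hσ_poly
    (TFNO.mem_closure_span_mean hσ.continuous hσ_poly
      ⟨((↑) : K → TFNO.Hs s d da), continuous_subtype_val⟩ Subtype.val_injective) Φ
  obtain ⟨Ψ, hΨ, hdist⟩ := Metric.mem_closure_iff.1 hΦ (ε / 2) (half_pos hε)
  obtain ⟨N, F, hN, hF⟩ := TFNO.exists_network_of_mem_span hk hσ hΨ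
  refine ⟨N, F, hN, F.continuous, ?_⟩
  refine lt_of_le_of_lt (iSup₂_le fun a ha => ?_)
    ((ENNReal.ofReal_lt_ofReal_iff hε).2 (half_lt_self hε))
  rw [← ofReal_norm]
  refine ENNReal.ofReal_le_ofReal ((ContinuousMap.norm_le _ (half_pos hε).le).2 fun t => ?_)
  have h1 := (ContinuousMap.dist_lt_iff (half_pos hε)).1 hdist (⟨a, ha⟩, t)
  rw [ContinuousMap.sub_apply, ← dist_eq_norm, hF ⟨a, ha⟩ t]
  exact h1.le
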